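/- Let $n\ge 1$, and let all vector spaces be over $\mathbb C$. Let $V_{n,3}$ be the vector space spanned by all bracketed permutations of $[2n-1]=\{1,\dots,2n-1\}$ with one inner and one outer $n$-ary bracket (words in which an outer bracket has one inner bracket and $n-1$ letters as its $n$ entries, the inner bracket has $n$ letters as its entries, and each letter of $[2n-1]$ occurs exactly once), subject only to the antisymmetry relations $$[x_1,\dots,x_n]=\operatorname{sgn}(\sigma)\,[x_{\sigma(1)},\dots,x_{\sigma(n)}]\qquad(\sigma\in S_n)$$ for the inner and for the outer bracket. The symmetric group $S_{2n-1}$ acts on $V_{n,3}$ by replacing each letter $x$ by $\tau(x)$. For an $n$-element subset $S=\{a_1<\dots<a_n\}$ of $[2n-1]$ with complement $\{b_1<\dots<b_{n-1}\}$ put $$v_S=[[a_1,\dots,a_n],b_1,\dots,b_{n-1}],\qquad R_S=v_S-\sum_{i=1}^n[a_1,\dots,a_{i-1},[a_i,b_1,\dots,b_{n-1}],a_{i+1},\dots,a_n].$$ The $v_S$ form a basis of $V_{n,3}$; let $\varphi:V_{n,3}\to V_{n,3}$ be the linear map with $\varphi(v_S)=R_S$ for all $S$. For a tableau $t$ of shape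 $\lambda\vdash N$ (a bijective filling by $[N]$) with row stabilizer $R_t$ and column stabilizer $C_t$, the Specht module $S^\lambda$ is the submodule of the regular representation $\mathbb C S_N$ spanned by $\{\tau e_t:\tau\in S_N\}$, where $e_t=\sum_{\alpha\in R_t}\alpha\,\sum_{\beta\in C_t}\operatorname{sgn}(\beta)\beta$. For each $0\le i\le n-1$ let $S^{2^i1^{2n-1-2i}}$ be formed with an arbitrary tableau of that shape. Then: 1. As $S_{2n-1}$-modules, $V_{n,3}\cong(\operatorname{sgn}_n\times\operatorname{sgn}_{n-1})\uparrow_{S_n\times S_{n-1}}^{S_{2n-1}}$. 2. The modules $S^{2^i1^{2n-1-2i}}$, $0\le i\le n-1$, are irreducible and pairwise non-isomorphic, and $V_{n,3}\cong\bigoplus_{i=0}^{n-1}S^{2^i1^{2n-1-2i}}$ as $S_{2n-1}$-modules. 3. For each $0\le i\le n-1$ there is exactly one submodule $W_i$ of $V_{n,3}$ isomorphic to $S^{2^i1^{2n-1-2i}}$; $V_{n,3}$ is the internal direct sum of $W_0,\dots,W_{n-1}$; and $\varphi$ acts on $W_i$ as the scalar $w_i=1+(n-i)(-1)^{n-i}$.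 4. $\ker\varphi=W_{n-1}$, the submodule of $V_{n,3}$ isomorphic to $S^{2^{n-1}1}$. -/

import Mathlib

open scoped MonoidAlgebra DirectSum

noncomputable section

/-! ### Bracketed permutations and the module `V_{n,3}`

The letters are the elements of `Fin (2 * n - 1)`, i.e. `1, …, 2n-1` shifted down by one. -/

/-- A bracketed permutation with one inner and one outer `n`-ary bracket: the inner bracket is
`[inner 0, …, inner (n-1)]`; the outer bracket has the entries `outer 0, …, outer (n-1)`, where
`none` marks the place of the inner bracket and `some x` is the letter `x`. Bijectivity says that
the inner bracket occurs exactly once in the outer one and that each letter is used exactly once. -/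
@[ext]
structure BracketWord (n : ℕ) where
  inner : Fin n → Fin (2 * n - 1)
  outer : Fin n → Option (Fin (2 * n - 1))
  bij : Function.Bijective (Sum.elim (fun j => some (inner j)) outer)

namespace BracketWord

variable {n : ℕ}

/-- The bijection from the `2n` slots of a word to the letters and the inner bracket. -/
def toEquiv (w : BracketWord n) : Fin n ⊕ Fin n ≃ Option (Fin (2 * n - 1)) :=
  Equiv.ofBijective _ w.bij

@[simp] theorem toEquiv_inl (w : BracketWord n) (j : Fin n) :
    w.toEquiv (Sum.inl j) = some (w.inner j) := rfl

@[simp] theorem toEquiv_inr (w : BracketWord n) (j : Fin n) :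
    w.toEquiv (Sum.inr j) = w.outer j := rfl

/-- Permute the entries of the inner bracket. -/
def permInner (σ : Equiv.Perm (Fin n)) (w : BracketWord n) : BracketWord n where
  inner := w.inner ∘ σ
  outer := w.outer
  bij := by
    convert ((Equiv.sumCongr σ (Equiv.refl (Fin n))).trans w.toEquiv).bijective using 1
    funext x
    rcases x with x | x <;> simp

/-- Permute the entries of the outer bracket (one of which is the inner bracket). -/
def permOuter (σ : Equiv.Perm (Fin n)) (w : BracketWord n) : BracketWord n where
  inner := w.inner
  outer := w.outer ∘ σ
  bij := by
    convert ((Equiv.sumCongr (Equiv.refl (Fin n)) σ).trans w.toEquiv).bijective using 1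
    funext x
    rcases x with x | x <;> simp

/-- Replace each letter `x` by `τ x`. -/
def relabel (τ : Equiv.Perm (Fin (2 * n - 1))) (w : BracketWord n) : BracketWord n where
  inner := fun j => τ (w.inner j)
  outer := fun j => (w.outer j).map τ
  bij := by
    convert (w.toEquiv.trans (Equiv.optionCongr τ)).bijective using 1
    funext x
    rcases x with x | x <;> simp

theorem relabel_one (w : BracketWord n) : relabel 1 w = w := by
  ext <;> simp [relabel]

theorem relabel_mul (σ τ : Equiv.Perm (Fin (2 * n - 1))) (w : BracketWord n) :
    relabel (σ * τ) w = relabel σ (relabel τ w) := by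
  ext <;> simp [relabel]

end BracketWord

/-- The antisymmetry relations `w - sgn(σ) w'`, where `w'` arises from the word `w` by permuting
the entries of the inner, or of the outer, bracket by `σ`. -/
def antisymmetryRelations (n : ℕ) : Set (BracketWord n →₀ ℂ) :=
  {x | ∃ (σ : Equiv.Perm (Fin n)) (w : BracketWord n),
    x = Finsupp.single w 1 -
        ((Equiv.Perm.sign σ : ℤ) : ℂ) • Finsupp.single (w.permInner σ) 1 ∨
    x = Finsupp.single w 1 -
        ((Equiv.Perm.sign σ : ℤ) : ℂ) • Finsupp.single (w.permOuter σ) 1}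

/-- `V_{n,3}`: the complex vector space spanned by the bracketed permutations of `2n-1` letters
with two `n`-ary brackets, subject only to antisymmetry of the brackets. -/
abbrev V3 (n : ℕ) : Type :=
  (BracketWord n →₀ ℂ) ⧸ Submodule.span ℂ (antisymmetryRelations n)

/-- The class of a bracketed permutation in `V_{n,3}`. -/
def V3.mk {n : ℕ} (w : BracketWord n) : V3 n :=
  (Submodule.span ℂ (antisymmetryRelations n)).mkQ (Finsupp.single w 1)

theorem V3.relabel_mem (n : ℕ) (τ : Equiv.Perm (Fin (2 * n - 1))) :
    Submodule.span ℂ (antisymmetryRelations n) ≤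
      (Submodule.span ℂ (antisymmetryRelations n)).comap
        (Finsupp.lmapDomain ℂ ℂ (BracketWord.relabel τ)) := by
  rw [Submodule.span_le]
  rintro x ⟨σ, w, h | h⟩ <;> subst h <;> refine Submodule.subset_span ⟨σ, w.relabel τ, ?_⟩
  · left
    simp only [Finsupp.lmapDomain_apply, map_sub, map_smul, Finsupp.mapDomain_single]
    rfl
  · right
    simp only [Finsupp.lmapDomain_apply, map_sub, map_smul, Finsupp.mapDomain_single]
    rfl

/-- The action of `S_{2n-1}` on `V_{n,3}` by replacing letters. -/
def V3.rep (n : ℕ) : Representation ℂ (Equiv.Perm (Fin (2 * n - 1))) (V3 n) where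
  toFun τ := Submodule.mapQ _ _ (Finsupp.lmapDomain ℂ ℂ (BracketWord.relabel τ))
    (V3.relabel_mem n τ)
  map_one' := by
    ext w
    simp [BracketWord.relabel_one]
  map_mul' σ τ := by
    ext w
    simp [BracketWord.relabel_mul]

/-! ### The basis `v_S` and the Jacobi map `φ` -/

/-- The `n`-element subsets of the set of `2n-1` letters. -/
abbrev NSubset (n : ℕ) : Type := {S : Finset (Fin (2 * n - 1)) // S.card = n}

namespace NSubset

variable {n : ℕ}

/-- The elements `a_1 < … < a_n` of `S`. -/
def a (S : NSubset n) : Fin n ↪o Fin (2 * n - 1) := S.1.orderEmbOfFin S.2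

/-- The elements `b_1 < … < b_{n-1}` of the complement of `S`. -/
def b (S : NSubset n) : Fin (n - 1) ↪o Fin (2 * n - 1) :=
  S.1ᶜ.orderEmbOfFin (by rw [Finset.card_compl, S.2, Fintype.card_fin]; omega)

theorem a_mem (S : NSubset n) (j : Fin n) : S.a j ∈ S.1 := S.1.orderEmbOfFin_mem S.2 j

theorem b_notMem (S : NSubset n) (j : Fin (n - 1)) : S.b j ∉ S.1 :=
  Finset.mem_compl.1 (S.1ᶜ.orderEmbOfFin_mem _ j)

theorem a_ne_b (S : NSubset n) (i : Fin n) (j : Fin (n - 1)) : S.a i ≠ S.b j :=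
  fun h => S.b_notMem j (h ▸ S.a_mem i)

variable [NeZero n]

/-- The position `j - 1` for a position `j ≠ 0`. -/
def predPos (j : Fin n) (h : j ≠ 0) : Fin (n - 1) :=
  ⟨(j : ℕ) - 1, by
    have h1 : (j : ℕ) ≠ 0 := fun h2 => h (Fin.ext (by simpa using h2))
    have h3 := j.isLt
    omega⟩

theorem predPos_inj {i j : Fin n} (hi : i ≠ 0) (hj : j ≠ 0) (h : predPos i hi = predPos j hj) :
    i = j := by
  have h1 : (i : ℕ) ≠ 0 := fun h2 => hi (Fin.ext (by simpa using h2))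
  have h2 : (j : ℕ) ≠ 0 := fun h2 => hj (Fin.ext (by simpa using h2))
  have h3 : (i : ℕ) - 1 = (j : ℕ) - 1 := congrArg Fin.val h
  exact Fin.ext (by omega)

theorem card_slots : Fintype.card (Fin n ⊕ Fin n) = Fintype.card (Option (Fin (2 * n - 1))) := by
  have := NeZero.ne n
  simp only [Fintype.card_sum, Fintype.card_fin, Fintype.card_option]
  omega

/-- The word `[[a_1, …, a_n], b_1, …, b_{n-1}]`. -/
def word (S : NSubset n) : BracketWord n where
  inner := S.a
  outer := fun j => if h : j = 0 then none else some (S.b (predPos j h))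
  bij := by
    rw [Fintype.bijective_iff_injective_and_card]
    refine ⟨?_, card_slots⟩
    rintro (i | i) (j | j) h
    · simpa using h
    · by_cases hj : j = 0
      · simp [hj] at h
      · simp [hj, S.a_ne_b] at h
    · by_cases hi : i = 0
      · simp [hi] at h
      · simp [hi, (S.a_ne_b _ _).symm] at h
    · by_cases hi : i = 0 <;> by_cases hj : j = 0 <;> simp [hi, hj] at h ⊢
      exact predPos_inj hi hj h

/-- The word `[a_1, …, a_{i-1}, [a_i, b_1, …, b_{n-1}], a_{i+1}, …, a_n]`. -/
def jacobiWord (S : NSubset n) (i : Fin n) : BracketWord n where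
  inner := fun j => if h : j = 0 then S.a i else S.b (predPos j h)
  outer := fun j => if j = i then none else some (S.a j)
  bij := by
    rw [Fintype.bijective_iff_injective_and_card]
    refine ⟨?_, card_slots⟩
    rintro (k | k) (j | j) h
    · by_cases hk : k = 0 <;> by_cases hj : j = 0 <;>
        simp [hk, hj, S.a_ne_b, (S.a_ne_b _ _).symm] at h ⊢
      exact predPos_inj hk hj h
    · by_cases hk : k = 0 <;> by_cases hj : j = i <;>
        simp [hk, hj, (S.a_ne_b _ _).symm] at h
      exact absurd h.symm hj
    · by_cases hk : k = i <;> by_cases hj : j = 0 <;>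
        simp [hk, hj, S.a_ne_b] at h
    · by_cases hk : k = i <;> by_cases hj : j = i <;> simp [hk, hj] at h ⊢
      exact h

/-- `v_S = [[a_1, …, a_n], b_1, …, b_{n-1}]` in `V_{n,3}`. -/
def v (S : NSubset n) : V3 n := V3.mk S.word

/-- The generalized Jacobi relation
`R_S = v_S - ∑ i, [a_1, …, a_{i-1}, [a_i, b_1, …, b_{n-1}], a_{i+1}, …, a_n]`. -/
def jacobiRelation (S : NSubset n) : V3 n := S.v - ∑ i : Fin n, V3.mk (S.jacobiWord i)

end NSubset

namespace V3

variable {n : ℕ}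

theorem mk_permInner (σ : Equiv.Perm (Fin n)) (w : BracketWord n) :
    mk w = ((Equiv.Perm.sign σ : ℤ) : ℂ) • mk (w.permInner σ) := by
  rw [mk, mk, ← map_smul, ← sub_eq_zero, ← map_sub]
  rw [Submodule.mkQ_apply, Submodule.Quotient.mk_eq_zero]
  exact Submodule.subset_span ⟨σ, w, Or.inl rfl⟩

theorem mk_permOuter (σ : Equiv.Perm (Fin n)) (w : BracketWord n) :
    mk w = ((Equiv.Perm.sign σ : ℤ) : ℂ) • mk (w.permOuter σ) := by
  rw [mk, mk, ← map_smul, ← sub_eq_zero, ← map_sub]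
  rw [Submodule.mkQ_apply, Submodule.Quotient.mk_eq_zero]
  exact Submodule.subset_span ⟨σ, w, Or.inr rfl⟩

variable [NeZero n]

/-- Coefficient of `v_S` in a word: used only to see that the `v_S` form a basis. -/
def wordCoeff (S : NSubset n) (w : BracketWord n) : ℂ :=
  if ∀ j, w.inner j ∈ S.1 then
    ((Equiv.Perm.sign (w.toEquiv.trans S.word.toEquiv.symm) : ℤ) : ℂ) else 0

theorem wordCoeff_permInner (S : NSubset n) (σ : Equiv.Perm (Fin n)) (w : BracketWord n) :
    wordCoeff S w = ((Equiv.Perm.sign σ : ℤ) : ℂ) * wordCoeff S (w.permInner σ) := by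
  have h : (w.permInner σ).toEquiv.trans S.word.toEquiv.symm =
      (w.toEquiv.trans S.word.toEquiv.symm : Equiv.Perm _) *
        Equiv.Perm.sumCongr σ (1 : Equiv.Perm (Fin n)) := by
    ext x
    rcases x with x | x <;> rfl
  have h2 : (∀ j, (w.permInner σ).inner j ∈ S.1) ↔ ∀ j, w.inner j ∈ S.1 :=
    ⟨fun h j => by simpa [BracketWord.permInner] using h (σ.symm j), fun h j => h (σ j)⟩
  unfold wordCoeff
  rw [h, Equiv.Perm.sign_mul, Equiv.Perm.sign_sumCongr]
  simp only [h2]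
  split_ifs
  · rcases Int.units_eq_one_or (Equiv.Perm.sign σ) with h | h <;> simp [h]
  · simp

theorem wordCoeff_permOuter (S : NSubset n) (σ : Equiv.Perm (Fin n)) (w : BracketWord n) :
    wordCoeff S w = ((Equiv.Perm.sign σ : ℤ) : ℂ) * wordCoeff S (w.permOuter σ) := by
  have h : (w.permOuter σ).toEquiv.trans S.word.toEquiv.symm =
      (w.toEquiv.trans S.word.toEquiv.symm : Equiv.Perm _) *
        Equiv.Perm.sumCongr (1 : Equiv.Perm (Fin n)) σ := by
    ext x
    rcases x with x | x <;> rfl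
  have h2 : (∀ j, (w.permOuter σ).inner j ∈ S.1) ↔ ∀ j, w.inner j ∈ S.1 := Iff.rfl
  unfold wordCoeff
  rw [h, Equiv.Perm.sign_mul, Equiv.Perm.sign_sumCongr]
  simp only [h2]
  split_ifs
  · rcases Int.units_eq_one_or (Equiv.Perm.sign σ) with h | h <;> simp [h]
  · simp

/-- The coefficient of `v_S` as a linear form on `V_{n,3}`. -/
def coeff (S : NSubset n) : V3 n →ₗ[ℂ] ℂ :=
  Submodule.liftQ _ (Finsupp.linearCombination ℂ (wordCoeff S)) (by
    rw [Submodule.span_le]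
    rintro x ⟨σ, w, h | h⟩ <;> subst h
    · simp [wordCoeff_permInner S σ w]
    · simp [wordCoeff_permOuter S σ w])

theorem coeff_v (S T : NSubset n) : coeff S T.v = if S = T then 1 else 0 := by
  have h0 : coeff S T.v = wordCoeff S T.word := by
    simp [coeff, NSubset.v, mk]
  rw [h0]
  by_cases h : S = T
  · subst h
    have h1 : ∀ j, S.word.inner j ∈ S.1 := S.a_mem
    simp [wordCoeff, h1]
  · rw [if_neg h, wordCoeff, if_neg]
    intro hj
    apply h
    have hsub : T.1 ⊆ S.1 := by
      intro x hx
      have hx' : x ∈ Set.range (T.1.orderEmbOfFin T.2) := by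
        rw [Finset.range_orderEmbOfFin]; exact hx
      obtain ⟨j, rfl⟩ := hx'
      exact hj j
    exact Subtype.ext (Finset.eq_of_subset_of_card_le hsub (by rw [S.2, T.2])).symm

theorem linearIndependent_v : LinearIndependent ℂ (fun S : NSubset n => S.v) := by
  rw [Fintype.linearIndependent_iff]
  intro g hg S
  have h := congrArg (coeff S) hg
  simpa [coeff_v] using h

theorem mk_mem_span (w : BracketWord n) :
    mk w ∈ Submodule.span ℂ (Set.range (fun S : NSubset n => S.v)) := by
  have hinj : Function.Injective w.inner := by
    intro i j h
    have : w.toEquiv (Sum.inl i) = w.toEquiv (Sum.inl j) := by simp [h]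
    simpa using w.toEquiv.injective this
  let S : NSubset n := ⟨Finset.univ.map ⟨w.inner, hinj⟩, by simp⟩
  let p : Equiv.Perm (Fin n ⊕ Fin n) := w.toEquiv.trans S.word.toEquiv.symm
  have hp : Set.MapsTo p (Set.range Sum.inl) (Set.range Sum.inl) := by
    rintro _ ⟨j, rfl⟩
    have hx : w.inner j ∈ Set.range (S.1.orderEmbOfFin S.2) := by
      rw [Finset.range_orderEmbOfFin]; simp [S]
    obtain ⟨k, hk⟩ := hx
    refine ⟨k, ?_⟩
    change Sum.inl k = S.word.toEquiv.symm (w.toEquiv (Sum.inl j))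
    rw [Equiv.eq_symm_apply]
    exact congrArg some hk
  obtain ⟨⟨σ₁, σ₂⟩, hσ⟩ := Equiv.Perm.mem_sumCongrHom_range_of_perm_mapsTo_inl hp
  have hw : w = (S.word.permInner σ₁).permOuter σ₂ := by
    have key : ∀ x, w.toEquiv x = S.word.toEquiv (Equiv.Perm.sumCongr σ₁ σ₂ x) := by
      intro x
      have h1 : Equiv.Perm.sumCongr σ₁ σ₂ = p := hσ
      rw [h1]
      simp [p]
    ext1
    · funext j
      exact Option.some_injective _ (key (Sum.inl j))
    · funext j
      exact key (Sum.inr j)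
  have h1 := mk_permInner σ₁ S.word
  have h2 := mk_permOuter σ₂ (S.word.permInner σ₁)
  rw [← hw] at h2
  have h3 : mk w = ((Equiv.Perm.sign σ₂ : ℤ) : ℂ) • ((Equiv.Perm.sign σ₁ : ℤ) : ℂ) • S.v := by
    rw [NSubset.v, h1, h2]
    rcases Int.units_eq_one_or (Equiv.Perm.sign σ₁) with h | h <;>
    rcases Int.units_eq_one_or (Equiv.Perm.sign σ₂) with h' | h' <;> simp [h, h']
  rw [h3]
  exact Submodule.smul_mem _ _ (Submodule.smul_mem _ _ (Submodule.subset_span ⟨S, rfl⟩))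

theorem span_v : ⊤ ≤ Submodule.span ℂ (Set.range (fun S : NSubset n => S.v)) := by
  rintro x -
  obtain ⟨y, rfl⟩ := Submodule.mkQ_surjective _ x
  induction y using Finsupp.induction_linear with
  | zero => simp
  | add f g hf hg => rw [map_add]; exact Submodule.add_mem _ hf hg
  | single w c =>
    have h : (Submodule.span ℂ (antisymmetryRelations n)).mkQ (Finsupp.single w c) = c • mk w := by
      rw [mk, ← map_smul, Finsupp.smul_single, smul_eq_mul, mul_one]
    rw [h]
    exact Submodule.smul_mem _ _ (mk_mem_span w)

/-- The basis `{v_S}` of `V_{n,3}`, indexed by the `n`-element sets of letters. -/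
def basis (n : ℕ) [NeZero n] : Module.Basis (NSubset n) ℂ (V3 n) :=
  Module.Basis.mk linearIndependent_v span_v

/-- The linear map `φ : V_{n,3} → V_{n,3}` with `φ(v_S) = R_S`. -/
def jacobiMap (n : ℕ) [NeZero n] : V3 n →ₗ[ℂ] V3 n :=
  (basis n).constr ℂ NSubset.jacobiRelation

theorem jacobiMap_v (S : NSubset n) : jacobiMap n S.v = S.jacobiRelation := by
  have h : basis n S = S.v := by simp [basis]
  rw [jacobiMap, ← h, Module.Basis.constr_basis]

end V3

/-! ### The induced module -/

/-- The Young subgroup `S_n × S_{n-1}` of `S_{2n-1}`: the first factor permutes the first `n`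
letters and the second factor permutes the last `n - 1` letters. -/
def youngSubgroupHom (n : ℕ) :
    Equiv.Perm (Fin n) × Equiv.Perm (Fin (n - 1)) →* Equiv.Perm (Fin (2 * n - 1)) :=
  ((finSumFinEquiv.trans (finCongr (by omega : n + (n - 1) = 2 * n - 1))).permCongrHom
    : _ →* Equiv.Perm (Fin (2 * n - 1))).comp
    (Equiv.Perm.sumCongrHom (Fin n) (Fin (n - 1)))

/-- The one-dimensional representation `sgn_n × sgn_{n-1}` of `S_n × S_{n-1}`. -/
def signRep (n : ℕ) : Representation ℂ (Equiv.Perm (Fin n) × Equiv.Perm (Fin (n - 1))) ℂ where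
  toFun g := (((Equiv.Perm.sign g.1 * Equiv.Perm.sign g.2 : ℤˣ) : ℤ) : ℂ) • LinearMap.id
  map_one' := by ext; simp
  map_mul' g h := by
    ext
    simp
    ring

/-! ### Specht modules -/

/-- A tableau of shape `μ`: a bijective filling of the cells of `μ` by `N` letters. -/
abbrev Tableau (μ : YoungDiagram) (N : ℕ) : Type := μ.cells ≃ Fin N

namespace Tableau

variable {μ : YoungDiagram} {N : ℕ}

/-- The row stabilizer: the permutations that keep each letter in its row. -/
def rowStabilizer (t : Tableau μ N) : Finset (Equiv.Perm (Fin N)) :=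
  {σ | ∀ x, (t.symm (σ x)).1.1 = (t.symm x).1.1}

/-- The column stabilizer: the permutations that keep each letter in its column. -/
def colStabilizer (t : Tableau μ N) : Finset (Equiv.Perm (Fin N)) :=
  {σ | ∀ x, (t.symm (σ x)).1.2 = (t.symm x).1.2}

/-- The Young symmetrizer `e_t = (∑_{α ∈ R_t} α) (∑_{β ∈ C_t} sgn(β) β)`. -/
def youngSymmetrizer (t : Tableau μ N) : ℂ[Equiv.Perm (Fin N)] :=
  (∑ α ∈ t.rowStabilizer, MonoidAlgebra.single α 1) *
    ∑ β ∈ t.colStabilizer, MonoidAlgebra.single β ((Equiv.Perm.sign β : ℤ) : ℂ)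

/-- The Specht module of `t`: the submodule of the (left) regular representation of `S_N` spanned
by the elements `τ e_t`, `τ ∈ S_N`. -/
def specht (t : Tableau μ N) :
    Subrepresentation (Representation.leftRegular ℂ (Equiv.Perm (Fin N))) where
  toSubmodule := Submodule.span ℂ (Set.range fun τ : Equiv.Perm (Fin N) =>
    Representation.leftRegular ℂ (Equiv.Perm (Fin N)) τ t.youngSymmetrizer)
  apply_mem_toSubmodule g x hx := by
    induction hx using Submodule.span_induction with
    | mem x h =>
      obtain ⟨τ, rfl⟩ := h
      refine Submodule.subset_span ⟨g * τ, ?_⟩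
      simp only [map_mul, Module.End.mul_apply]
    | zero => simp
    | add x y _ _ hx hy => rw [map_add]; exact Submodule.add_mem _ hx hy
    | smul c x _ hx => rw [map_smul]; exact Submodule.smul_mem _ _ hx

/-- The Specht module of `t` as a representation of `S_N`. -/
abbrev spechtRep (t : Tableau μ N) :
    Representation ℂ (Equiv.Perm (Fin N)) t.specht.toSubmodule :=
  t.specht.toRepresentation

end Tableau

/-- The Young diagram of shape `2^i 1^(2n-1-2i)`: `i` rows of length two, followed by `2n-1-2i`
rows of length one. -/
def twoColumnShape (n i : ℕ) : YoungDiagram :=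
  YoungDiagram.ofRowLens (List.replicate i 2 ++ List.replicate (2 * n - 1 - 2 * i) 1) (by
    rw [List.sortedGE_iff_pairwise, List.pairwise_append]
    refine ⟨by simp [List.pairwise_replicate], by simp [List.pairwise_replicate], ?_⟩
    intro x hx y hy
    rw [List.eq_of_mem_replicate hx, List.eq_of_mem_replicate hy]
    norm_num)

theorem card_cellsOfRowLens (w : List ℕ) : (YoungDiagram.cellsOfRowLens w).card = w.sum := by
  induction w with
  | nil => rfl
  | cons a w ih =>
    rw [YoungDiagram.cellsOfRowLens, Finset.card_union_of_disjoint]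
    · simp [ih]
    · rw [Finset.disjoint_left]
      rintro ⟨x, y⟩ hx hy
      simp at hx hy
      omega

/-- Tableaux of shape `2^i 1^(2n-1-2i)` with `2n-1` letters exist for `0 ≤ i < n`. -/
theorem tableau_nonempty (n : ℕ) (i : Fin n) :
    Nonempty (Tableau (twoColumnShape n i) (2 * n - 1)) := by
  have h : (twoColumnShape n i).cells.card = 2 * n - 1 := by
    have h1 : (twoColumnShape n i).cells = YoungDiagram.cellsOfRowLens
      (List.replicate i 2 ++ List.replicate (2 * n - 1 - 2 * i) 1) := rfl
    have hi := i.isLt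
    rw [h1, card_cellsOfRowLens, List.sum_append, List.sum_replicate, List.sum_replicate]
    simp only [smul_eq_mul]
    omega
  exact ⟨(twoColumnShape n i).cells.equivFinOfCardEq h⟩

end

/-! Recording a word by the set S of its inner letters together with a sign identifies V_{n,3} with
the functions F on n-subsets of the 2n-1 letters, permutations acting with a sign twist
(`V3.coord_rep`). In these coordinates φ sends F to S ↦ F(S) + (-1)^n ∑_{a ∈ S} F({a} ∪ Sᶜ)
(`V3.coord_jacobiMap`).

The commutant is small. An equivariant endomorphism is determined by one matrix entry for each orbit
on pairs of n-sets. An orbit is given by the size of the intersection, which lies between 1 and n,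
so the commutant embeds into ℂ^n (`V3.eq_zero_of_orbitEntries_eq_zero`).

The eigenvalues of φ are many. Let Q be the second column of a tableau t, with #Q = i. Applied to
the function B ↦ [Q ⊆ B], the element e_t gives a nonzero multiple of ∏_{x ∈ Q} ([x ∈ B] - [x' ∈
B]), where x' is the row neighbour of x. All functions F obtained in this way from the Specht module
satisfy Euler's identity ∑_{a ∈ B} F(B \ a) = (#B - i) F(B) (`sum_setFun_erase`) and F(Bᶜ) = (-1)^i
F(B) (`Tableau.setFun_compl`). The two identities show that the Specht module embeds into V_{n,3}
(`V3.ofSpecht_injective`) and that φ is the scalar w_i on its image (`V3.jacobiMap_ofSpecht`).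

The n numbers w_i are distinct, so the n Lagrange polynomials in φ already span the commutant. Hence
V_{n,3} is the sum of the eigenspaces of φ, and every equivariant endomorphism is scalar on each of
them. With Maschke's projections this makes each eigenspace irreducible, equal to the image of its
Specht module, and the only submodule of its isomorphism type. -/

/-! ### Commutants generated by an operator with enough eigenvalues -/

section Commutant

variable {V ι : Type*} [AddCommGroup V] [Module ℂ V] [Fintype ι] [DecidableEq ι]

theorem Subalgebra.aeval_mem_of_mem {R : Type*} [Ring R] [Algebra ℂ R] (A : Subalgebra ℂ R) {x : R}
    (hx : x ∈ A) (p : Polynomial ℂ) : Polynomial.aeval x p ∈ A :=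
  Algebra.adjoin_le (Set.singleton_subset_iff.2 hx) (Polynomial.aeval_mem_adjoin_singleton ℂ x)

theorem Module.End.aeval_lagrangeBasis_apply (φ : Module.End ℂ V) {w : ι → ℂ}
    (hw : Function.Injective w) (i j : ι) {x : V} (hx : x ∈ φ.eigenspace (w j)) :
    Polynomial.aeval φ (Lagrange.basis Finset.univ w i) x = if i = j then x else 0 := by
  by_cases h0 : x = 0
  · simp [h0]
  rw [Module.End.aeval_apply_of_hasEigenvector ⟨hx, h0⟩]
  split_ifs with h
  · subst h
    rw [Lagrange.eval_basis_self hw.injOn (Finset.mem_univ _), one_smul]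
  · rw [Lagrange.eval_basis_of_ne h (Finset.mem_univ _), zero_smul]

/-- If a subalgebra `A` of `End V` containing `φ` embeds linearly into `ι → ℂ`, and `φ` has
eigenvalues `w i`, `i : ι`, that are pairwise distinct, then `A` is spanned by the Lagrange
polynomials in `φ`. -/
theorem Subalgebra.exists_eq_sum_lagrangeBasis (φ : Module.End ℂ V) {w : ι → ℂ}
    (hw : Function.Injective w) (hne : ∀ i, φ.eigenspace (w i) ≠ ⊥)
    (A : Subalgebra ℂ (Module.End ℂ V)) (hφ : φ ∈ A)
    (ev : Module.End ℂ V →ₗ[ℂ] (ι → ℂ)) (hev : ∀ T ∈ A, ev T = 0 → T = 0)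
    {T : Module.End ℂ V} (hT : T ∈ A) :
    ∃ c : ι → ℂ, T = ∑ i, c i • Polynomial.aeval φ (Lagrange.basis Finset.univ w i) := by
  let L : (ι → ℂ) →ₗ[ℂ] Module.End ℂ V :=
    Fintype.linearCombination ℂ fun i => Polynomial.aeval φ (Lagrange.basis Finset.univ w i)
  have hL : ∀ c, L c = ∑ i, c i • Polynomial.aeval φ (Lagrange.basis Finset.univ w i) :=
    fun c => Fintype.linearCombination_apply ..
  have hLA : ∀ c, L c ∈ A := fun c => by
    rw [hL]
    refine sum_mem fun i _ => A.smul_mem ?_ _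
    exact A.aeval_mem_of_mem hφ _
  -- The coefficient `c j` is recovered from the action of `L c` on an eigenvector for `w j`.
  have hinj : Function.Injective (ev ∘ₗ L) := by
    rw [← LinearMap.ker_eq_bot, LinearMap.ker_eq_bot']
    intro c hc
    have h1 : L c = 0 := hev _ (hLA c) hc
    funext j
    obtain ⟨x, hx, hx0⟩ := Submodule.exists_mem_ne_zero_of_ne_bot (hne j)
    have h2 : L c x = c j • x := by
      rw [hL, LinearMap.sum_apply]
      simp [Module.End.aeval_lagrangeBasis_apply φ hw _ j hx]
    rw [h1, LinearMap.zero_apply] at h2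
    exact (smul_eq_zero.1 h2.symm).resolve_right hx0
  -- An injective endomorphism of `ι → ℂ` is surjective, so some `L c` has the same image as `T`
  -- under `ev`, which is injective on `A`.
  obtain ⟨c, hc⟩ := LinearMap.surjective_of_injective hinj (ev T)
  refine ⟨c, ?_⟩
  rw [← hL, ← sub_eq_zero]
  exact hev _ (sub_mem hT (hLA c)) (by rw [map_sub, sub_eq_zero]; exact hc.symm)

/-- This takes the place of Schur's lemma: it will be applied with `A` the commutant, before
irreducibility of the eigenspaces is known. -/
theorem Subalgebra.exists_smul_on_eigenspaces (φ : Module.End ℂ V) {w : ι → ℂ}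
    (hw : Function.Injective w) (hne : ∀ i, φ.eigenspace (w i) ≠ ⊥)
    (A : Subalgebra ℂ (Module.End ℂ V)) (hφ : φ ∈ A)
    (ev : Module.End ℂ V →ₗ[ℂ] (ι → ℂ)) (hev : ∀ T ∈ A, ev T = 0 → T = 0)
    {T : Module.End ℂ V} (hT : T ∈ A) :
    ∃ c : ι → ℂ, ∀ i, ∀ x ∈ φ.eigenspace (w i), T x = c i • x := by
  obtain ⟨c, hc⟩ := Subalgebra.exists_eq_sum_lagrangeBasis φ hw hne A hφ ev hev hT
  refine ⟨c, fun i x hx => ?_⟩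
  rw [hc, LinearMap.sum_apply]
  simp [Module.End.aeval_lagrangeBasis_apply φ hw _ i hx]

/-- Let P_i be the i-th Lagrange polynomial in φ. The product φ P_i lies in `A`, hence is a
combination of the P_j; evaluation on eigenvectors shows that it is w_i P_i. So P_i maps into the
eigenspace of w_i, and the P_i sum to 1. -/
theorem Subalgebra.iSup_eigenspace_eq_top [Nonempty ι] (φ : Module.End ℂ V) {w : ι → ℂ}
    (hw : Function.Injective w) (hne : ∀ i, φ.eigenspace (w i) ≠ ⊥)
    (A : Subalgebra ℂ (Module.End ℂ V)) (hφ : φ ∈ A)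
    (ev : Module.End ℂ V →ₗ[ℂ] (ι → ℂ)) (hev : ∀ T ∈ A, ev T = 0 → T = 0) :
    ⨆ i, φ.eigenspace (w i) = ⊤ := by
  have hP : ∀ i, φ * Polynomial.aeval φ (Lagrange.basis Finset.univ w i) =
      w i • Polynomial.aeval φ (Lagrange.basis Finset.univ w i) := by
    intro i
    obtain ⟨c, hc⟩ := Subalgebra.exists_eq_sum_lagrangeBasis φ hw hne A hφ ev hev
      (A.mul_mem hφ (A.aeval_mem_of_mem hφ (Lagrange.basis Finset.univ w i)))
    have hcj : ∀ j, c j = if i = j then w i else 0 := by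
      intro j
      obtain ⟨x, hx, hx0⟩ := Submodule.exists_mem_ne_zero_of_ne_bot (hne j)
      have h2 := congrArg (fun f : Module.End ℂ V => f x) hc
      simp only [Module.End.mul_apply, LinearMap.sum_apply, LinearMap.smul_apply,
        Module.End.aeval_lagrangeBasis_apply φ hw _ j hx, smul_ite, smul_zero,
        Finset.sum_ite_eq', Finset.mem_univ, if_true] at h2
      refine smul_left_injective ℂ hx0 ?_
      change c j • x = _ • x
      rw [← h2]
      split_ifs with h
      · subst h
        exact Module.End.mem_eigenspace_iff.1 hx
      · simp
    rw [hc]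
    simp [hcj]
  rw [eq_top_iff]
  rintro x -
  have h1 : ∑ i, Polynomial.aeval φ (Lagrange.basis Finset.univ w i) x = x := by
    rw [← LinearMap.sum_apply, ← map_sum, Lagrange.sum_basis hw.injOn Finset.univ_nonempty]
    simp
  rw [← h1]
  refine Submodule.sum_mem _ fun i _ => Submodule.mem_iSup_of_mem i ?_
  rw [Module.End.mem_eigenspace_iff]
  exact congrArg (fun f : Module.End ℂ V => f x) (hP i)

end Commutant

/-! ### Subrepresentations on which the commutant is scalar -/

section Maschke

variable {G V X ι : Type*} [Group G] [Finite G] [AddCommGroup V] [Module ℂ V] [AddCommGroup X]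
  [Module ℂ X] {ρ : Representation ℂ G V} {σ : Representation ℂ G X}

/-- Maschke: an equivariant projection onto a subrepresentation. -/
theorem Subrepresentation.exists_projection (U : Subrepresentation ρ) :
    ∃ P : Module.End ℂ V, (∀ g, P * ρ g = ρ g * P) ∧ (∀ x, P x ∈ U) ∧ ∀ x ∈ U, P x = x := by
  have : NeZero (Nat.card G : ℂ) := ⟨Nat.cast_ne_zero.2 Nat.card_pos.ne'⟩
  obtain ⟨U', hU⟩ := exists_isCompl U
  have hc : IsCompl U.toSubmodule U'.toSubmodule := by
    refine ⟨disjoint_iff.2 ?_, codisjoint_iff.2 ?_⟩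
    · exact congrArg Subrepresentation.toSubmodule hU.inf_eq_bot
    · exact congrArg Subrepresentation.toSubmodule hU.sup_eq_top
  have hL : ∀ x ∈ U, Submodule.projection _ _ hc x = x := fun x hx =>
    Submodule.projection_apply_left hc ⟨x, hx⟩
  have hR : ∀ x ∈ U', Submodule.projection _ _ hc x = 0 := fun x hx =>
    (Submodule.projection_apply_eq_zero_iff hc).2 hx
  refine ⟨Submodule.projection _ _ hc, fun g => ?_, fun x => Submodule.projection_apply_mem hc x, hL⟩
  ext x
  obtain ⟨y, hy, z, hz, rfl⟩ : ∃ y ∈ U.toSubmodule, ∃ z ∈ U'.toSubmodule, y + z = x :=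
    Submodule.mem_sup.1 (by rw [hc.sup_eq_top]; trivial)
  simp only [Module.End.mul_apply, map_add, hL y hy, hR z hz,
    hL _ (U.apply_mem_toSubmodule g hy), hR _ (U'.apply_mem_toSubmodule g hz), map_zero]

/-- The image of a subrepresentation under an intertwining map. -/
def Subrepresentation.mapIntertwining (f : σ.IntertwiningMap ρ) (U : Subrepresentation σ) :
    Subrepresentation ρ where
  toSubmodule := U.toSubmodule.map f.toLinearMap
  apply_mem_toSubmodule g v := by
    rintro ⟨x, hx, rfl⟩
    exact ⟨σ g x, U.apply_mem_toSubmodule g hx,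
      LinearMap.congr_fun (f.isIntertwining' g) x⟩

/-- Every equivariant endomorphism acts as a scalar on `E`. -/
def Subrepresentation.IsScalarOn (E : Subrepresentation ρ) : Prop :=
  ∀ T : Module.End ℂ V, (∀ g, T * ρ g = ρ g * T) → ∃ c : ℂ, ∀ x ∈ E, T x = c • x

/-- An equivariant projection onto f(U) is a scalar on `E`. It fixes a nonzero vector of f(U) ⊆ E,
so the scalar is 1 and all of `E` lies in f(U). -/
theorem Subrepresentation.IsScalarOn.map_eq {E : Subrepresentation ρ} (hE : E.IsScalarOn)
    {f : σ.IntertwiningMap ρ} (hf : Function.Injective f.toLinearMap)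
    (hfE : ∀ x, f.toLinearMap x ∈ E) (U : Subrepresentation σ)
    (hU : U ≠ ⊥) : U.toSubmodule.map f.toLinearMap = E.toSubmodule := by
  obtain ⟨P, hPc, hPU, hPid⟩ := (U.mapIntertwining f).exists_projection
  obtain ⟨c, hc⟩ := hE P hPc
  have hne : U.toSubmodule ≠ ⊥ := fun h => hU (Subrepresentation.toSubmodule_injective h)
  obtain ⟨x, hx, hx0⟩ := Submodule.exists_mem_ne_zero_of_ne_bot hne
  have hfx0 : f.toLinearMap x ≠ 0 := fun h => hx0 (hf (by rw [h, map_zero]))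
  have h1 : P (f.toLinearMap x) = f.toLinearMap x := hPid _ ⟨x, hx, rfl⟩
  have hc1 : c = 1 := by
    refine smul_left_injective ℂ hfx0 ?_
    change c • _ = (1 : ℂ) • _
    rw [← hc _ (hfE x), h1, one_smul]
  apply le_antisymm
  · rintro _ ⟨y, -, rfl⟩
    exact hfE y
  · intro y hy
    have h2 := hc y hy
    rw [hc1, one_smul] at h2
    rw [← h2]
    exact hPU y

theorem Subrepresentation.IsScalarOn.range_eq [Nontrivial X] {E : Subrepresentation ρ}
    (hE : E.IsScalarOn) {f : σ.IntertwiningMap ρ} (hf : Function.Injective f.toLinearMap)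
    (hfE : ∀ x, f.toLinearMap x ∈ E) : LinearMap.range f.toLinearMap = E.toSubmodule := by
  rw [LinearMap.range_eq_map]
  refine hE.map_eq hf hfE ⊤ fun h => ?_
  exact (top_ne_bot (α := Submodule ℂ X)) (congrArg Subrepresentation.toSubmodule h)

/-- A nonzero U has the same image `E` as the whole space, and f is injective. -/
theorem Subrepresentation.IsScalarOn.isIrreducible [Nontrivial X] {E : Subrepresentation ρ}
    (hE : E.IsScalarOn) {f : σ.IntertwiningMap ρ} (hf : Function.Injective f.toLinearMap)
    (hfE : ∀ x, f.toLinearMap x ∈ E) : σ.IsIrreducible where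
  exists_pair_ne := ⟨⊥, ⊤, fun h =>
    (bot_ne_top (α := Submodule ℂ X)) (congrArg Subrepresentation.toSubmodule h)⟩
  eq_bot_or_eq_top U := by
    by_cases hU : U = ⊥
    · exact Or.inl hU
    · right
      have h1 := hE.map_eq hf hfE U hU
      rw [← hE.range_eq hf hfE, LinearMap.range_eq_map] at h1
      exact Subrepresentation.toSubmodule_injective (Submodule.map_injective_of_injective hf h1)

/-- The isomorphism onto `E`. -/
noncomputable def Subrepresentation.equivOfRangeEq {E : Subrepresentation ρ}
    {f : σ.IntertwiningMap ρ} (hf : Function.Injective f.toLinearMap)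
    (h : LinearMap.range f.toLinearMap = E.toSubmodule) : E.toRepresentation.Equiv σ :=
  (Representation.Equiv.mk ((LinearEquiv.ofInjective f.toLinearMap hf).trans
    (LinearEquiv.ofEq _ _ h)) (fun g => by
      ext x
      exact LinearMap.congr_fun (f.isIntertwining' g) x) : σ.Equiv E.toRepresentation).symm

/-- A subrepresentation isomorphic to a nonzero `E` on which equivariant endomorphisms are scalar
is equal to `E`. -/
theorem Subrepresentation.IsScalarOn.eq_of_equiv {E U : Subrepresentation ρ}
    (hE : E.IsScalarOn) (hne : E ≠ ⊥) (e : E.toRepresentation.Equiv U.toRepresentation) :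
    U = E := by
  obtain ⟨P, hPc, hPE, hPid⟩ := E.exists_projection
  -- Projecting to `E` and then applying `e` is an equivariant endomorphism of V, so `e` is
  -- multiplication by some `c` on `E`. As `e` is injective, `c ≠ 0`, and the image `U` of `e` is
  -- `E`.
  let T : Module.End ℂ V := U.toSubmodule.subtype ∘ₗ e.toIntertwiningMap.toLinearMap ∘ₗ
    P.codRestrict E.toSubmodule hPE
  have hTe : ∀ x (hx : x ∈ E.toSubmodule), T x = (e.toLinearEquiv ⟨x, hx⟩ : V) := by
    intro x hx
    have h1 : P.codRestrict E.toSubmodule hPE x = ⟨x, hx⟩ := Subtype.ext (hPid x hx)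
    simp only [T, LinearMap.comp_apply, h1]
    rfl
  obtain ⟨c, hc⟩ := hE T (fun g => by
    ext x
    have h1 : P.codRestrict E.toSubmodule hPE (ρ g x) =
        E.toRepresentation g (P.codRestrict E.toSubmodule hPE x) :=
      Subtype.ext (LinearMap.congr_fun (hPc g) x)
    have h2 := LinearMap.congr_fun (e.toIntertwiningMap.isIntertwining' g)
      (P.codRestrict E.toSubmodule hPE x)
    simp only [LinearMap.comp_apply] at h2
    simp only [T, Module.End.mul_apply, LinearMap.comp_apply, h1, h2]
    rfl)
  have hne' : E.toSubmodule ≠ ⊥ := fun h => hne (Subrepresentation.toSubmodule_injective h)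
  obtain ⟨x, hx, hx0⟩ := Submodule.exists_mem_ne_zero_of_ne_bot hne'
  have hc0 : c ≠ 0 := by
    rintro rfl
    have h1 := hc x hx
    rw [hTe x hx, zero_smul] at h1
    have h2 : e.toLinearEquiv ⟨x, hx⟩ = 0 := Subtype.ext h1
    rw [LinearEquiv.map_eq_zero_iff] at h2
    exact hx0 (congrArg Subtype.val h2)
  apply Subrepresentation.toSubmodule_injective
  apply le_antisymm
  · intro y hy
    obtain ⟨z, hz⟩ := e.toLinearEquiv.surjective ⟨y, hy⟩
    have h1 := hc z.1 z.2
    rw [hTe z.1 z.2] at h1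
    have h2 : (e.toLinearEquiv ⟨z.1, z.2⟩ : V) = y := congrArg Subtype.val hz
    rw [← h2, h1]
    exact E.toSubmodule.smul_mem _ z.2
  · intro y hy
    have h1 := hc y hy
    rw [hTe y hy] at h1
    have h2 : y = c⁻¹ • (e.toLinearEquiv ⟨y, hy⟩ : V) := by rw [h1, inv_smul_smul₀ hc0]
    rw [h2]
    exact U.toSubmodule.smul_mem _ (Subtype.prop _)

end Maschke

/-! ### Realization of V_{n,3} by sign-twisted functions on n-sets -/

noncomputable section

section SumSwap

/-- The exchange of the two summands of `α ⊕ α` is a product of `|α|` transpositions. -/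
theorem Equiv.Perm.sign_sumComm (α : Type*) [Fintype α] [DecidableEq α] :
    Equiv.Perm.sign (Equiv.sumComm α α : Equiv.Perm (α ⊕ α)) = (-1) ^ Fintype.card α := by
  have h : (Equiv.sumComm α α : Equiv.Perm (α ⊕ α)) =
      (Equiv.boolProdEquivSum α).permCongr
        (Equiv.prodCongrLeft fun _ : α => Equiv.swap false true) := by
    ext x
    rcases x with x | x <;> simp [Equiv.permCongr_apply, Equiv.boolProdEquivSum]
  rw [h, Equiv.Perm.sign_permCongr, Equiv.Perm.sign_prodCongrLeft]
  simp

end SumSwap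

namespace BracketWord

variable {n : ℕ}

/-- The set of letters of the inner bracket. -/
def innerSet (w : BracketWord n) : Finset (Fin (2 * n - 1)) := Finset.univ.image w.inner

theorem inner_injective (w : BracketWord n) : Function.Injective w.inner := fun i j h =>
  Sum.inl_injective (w.toEquiv.injective (by simp [h]))

theorem card_innerSet (w : BracketWord n) : w.innerSet.card = n := by
  rw [innerSet, Finset.card_image_of_injective _ w.inner_injective, Finset.card_fin]

theorem innerSet_permInner (σ : Equiv.Perm (Fin n)) (w : BracketWord n) :
    (w.permInner σ).innerSet = w.innerSet := by
  ext x
  simp only [innerSet, permInner, Finset.mem_image, Finset.mem_univ, true_and,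
    Function.comp_apply]
  exact (σ.surjective.exists (p := fun a => w.inner a = x)).symm

theorem innerSet_permOuter (σ : Equiv.Perm (Fin n)) (w : BracketWord n) :
    (w.permOuter σ).innerSet = w.innerSet := rfl

theorem innerSet_relabel (τ : Equiv.Perm (Fin (2 * n - 1))) (w : BracketWord n) :
    (w.relabel τ).innerSet = w.innerSet.map τ.toEmbedding := by
  rw [innerSet, innerSet, Finset.map_eq_image, Finset.image_image]
  rfl

variable [NeZero n]

/-- A reference bijection from the slots of a word to the letters and the inner bracket. -/
def refEquiv (n : ℕ) [NeZero n] : Fin n ⊕ Fin n ≃ Option (Fin (2 * n - 1)) :=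
  Fintype.equivOfCardEq NSubset.card_slots

/-- The sign of a word, relative to the reference bijection. -/
def sgn (w : BracketWord n) : ℤˣ :=
  Equiv.Perm.sign (w.toEquiv.trans (refEquiv n).symm : Equiv.Perm (Fin n ⊕ Fin n))

theorem sgn_of_toEquiv_eq {w w' : BracketWord n} {p : Equiv.Perm (Fin n ⊕ Fin n)}
    (h : ∀ x, w'.toEquiv x = w.toEquiv (p x)) : w'.sgn = Equiv.Perm.sign p * w.sgn := by
  have h1 : (w'.toEquiv.trans (refEquiv n).symm : Equiv.Perm (Fin n ⊕ Fin n)) =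
      (w.toEquiv.trans (refEquiv n).symm : Equiv.Perm (Fin n ⊕ Fin n)) * p := by
    ext1 x
    simp [h]
  rw [sgn, h1, Equiv.Perm.sign_mul, mul_comm]
  rfl

theorem sgn_permInner (σ : Equiv.Perm (Fin n)) (w : BracketWord n) :
    (w.permInner σ).sgn = Equiv.Perm.sign σ * w.sgn := by
  rw [sgn_of_toEquiv_eq (w := w) (p := Equiv.Perm.sumCongr σ 1), Equiv.Perm.sign_sumCongr,
    Equiv.Perm.sign_one, mul_one]
  rintro (x | x) <;> rfl

theorem sgn_permOuter (σ : Equiv.Perm (Fin n)) (w : BracketWord n) :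
    (w.permOuter σ).sgn = Equiv.Perm.sign σ * w.sgn := by
  rw [sgn_of_toEquiv_eq (w := w) (p := Equiv.Perm.sumCongr 1 σ), Equiv.Perm.sign_sumCongr,
    Equiv.Perm.sign_one, one_mul]
  rintro (x | x) <;> rfl

/-- A relabelling permutes letters, not slots. Conjugation by `w.toEquiv` turns it into a
permutation of the slots with the same sign, and fixing the extra point `none` does not alter the
sign. -/
theorem sgn_relabel (τ : Equiv.Perm (Fin (2 * n - 1))) (w : BracketWord n) :
    (w.relabel τ).sgn = Equiv.Perm.sign τ * w.sgn := by
  rw [sgn_of_toEquiv_eq (w := w) (p := (w.toEquiv.trans (Equiv.optionCongr τ)).trans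
    w.toEquiv.symm), Equiv.trans_assoc, ← Equiv.optionCongr_sign τ,
    ← Equiv.Perm.sign_symm_trans_trans (Equiv.optionCongr τ) w.toEquiv.symm]
  · rfl
  · intro x
    rcases x with x | x <;> simp [relabel]

end BracketWord

namespace NSubset

variable {n : ℕ}

theorem exists_b_eq (S : NSubset n) {x : Fin (2 * n - 1)} (hx : x ∉ S.1) : ∃ j, S.b j = x := by
  have h : x ∈ Set.range S.b := by
    rw [b, Finset.range_orderEmbOfFin]; simpa using hx
  exact h

theorem exists_a_eq (S : NSubset n) {x : Fin (2 * n - 1)} (hx : x ∈ S.1) : ∃ j, S.a j = x := by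
  have h : x ∈ Set.range S.a := by
    rw [a, Finset.range_orderEmbOfFin]; simpa using hx
  exact h

variable [NeZero n]

theorem innerSet_word (S : NSubset n) : S.word.innerSet = S.1 := by
  ext x
  have h : x ∈ Set.range (S.1.orderEmbOfFin S.2) ↔ x ∈ S.1 := by
    rw [Finset.range_orderEmbOfFin]; rfl
  rw [← h]
  simp [BracketWord.innerSet, word, a]

theorem innerSet_jacobiWord (S : NSubset n) (i : Fin n) :
    (S.jacobiWord i).innerSet = insert (S.a i) S.1ᶜ := by
  symm
  apply Finset.eq_of_subset_of_card_le
  · intro x hx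
    simp only [BracketWord.innerSet, jacobiWord, Finset.mem_image, Finset.mem_univ, true_and]
    rcases Finset.mem_insert.1 hx with rfl | hx
    · exact ⟨0, by simp⟩
    · obtain ⟨j, rfl⟩ := S.exists_b_eq (Finset.mem_compl.1 hx)
      have hj := j.isLt
      -- Slot 0 of the inner bracket holds a_i, so the `j`-th element of the complement sits in slot
      -- `j + 1`.
      refine ⟨⟨j + 1, by omega⟩, ?_⟩
      have h0 : (⟨j + 1, by omega⟩ : Fin n) ≠ 0 := by
        intro h
        have := congrArg Fin.val h
        simp at this
      rw [dif_neg h0]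
      congr 1
  · rw [BracketWord.card_innerSet, Finset.card_insert_of_notMem (by simp [S.a_mem]),
      Finset.card_compl, S.2, Fintype.card_fin]
    have := NeZero.ne n
    omega

/-- The word arises from v_S by exchanging the entries of the two brackets, of sign (-1)^n, followed
by one transposition that trades a_i for the inner bracket. The sign is therefore independent of
`i`. -/
theorem sgn_jacobiWord (S : NSubset n) (i : Fin n) :
    (S.jacobiWord i).sgn = -((-1) ^ n * S.word.sgn) := by
  rw [BracketWord.sgn_of_toEquiv_eq (w := S.word)
    (p := Equiv.swap (Sum.inl i) (Sum.inr 0) * Equiv.sumComm (Fin n) (Fin n)),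
    Equiv.Perm.sign_mul, Equiv.Perm.sign_swap (by simp), Equiv.Perm.sign_sumComm,
    Fintype.card_fin, neg_mul, one_mul, neg_mul]
  rintro (j | j)
  · by_cases hj : j = 0
    · subst hj
      simp [jacobiWord, word]
    · rw [Equiv.Perm.mul_apply, Equiv.sumComm_apply, Sum.swap_inl,
        Equiv.swap_apply_of_ne_of_ne (by simp) (by simpa using hj)]
      simp [jacobiWord, word, hj]
  · by_cases hj : j = i
    · subst hj
      simp [jacobiWord, word]
    · rw [Equiv.Perm.mul_apply, Equiv.sumComm_apply, Sum.swap_inr,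
        Equiv.swap_apply_of_ne_of_ne (by simpa using hj) (by simp)]
      simp [jacobiWord, word, hj]

end NSubset

namespace V3

variable {n : ℕ}

theorem rep_mk (τ : Equiv.Perm (Fin (2 * n - 1))) (w : BracketWord n) :
    V3.rep n τ (mk w) = mk (w.relabel τ) := by
  simp [V3.rep, mk]

variable [NeZero n]

/-- The realization of `V_{n,3}` by functions on the sets of letters: the class of a word is mapped
to its sign at the set of its inner letters. -/
def coord (n : ℕ) [NeZero n] : V3 n →ₗ[ℂ] (Finset (Fin (2 * n - 1)) → ℂ) :=
  Submodule.liftQ _ (Finsupp.linearCombination ℂ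
    fun w : BracketWord n => Pi.single w.innerSet (((w.sgn : ℤˣ) : ℤ) : ℂ)) (by
    rw [Submodule.span_le]
    rintro x ⟨σ, w, h | h⟩ <;> subst h
    · simp only [SetLike.mem_coe, LinearMap.mem_ker, map_sub, map_smul,
        Finsupp.linearCombination_single, one_smul, BracketWord.innerSet_permInner,
        BracketWord.sgn_permInner]
      rcases Int.units_eq_one_or (Equiv.Perm.sign σ) with h | h <;> simp [h, ← Pi.single_add]
    · simp only [SetLike.mem_coe, LinearMap.mem_ker, map_sub, map_smul,
        Finsupp.linearCombination_single, one_smul, BracketWord.innerSet_permOuter,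
        BracketWord.sgn_permOuter]
      rcases Int.units_eq_one_or (Equiv.Perm.sign σ) with h | h <;> simp [h, ← Pi.single_add])

theorem coord_mk (w : BracketWord n) :
    coord n (mk w) = Pi.single w.innerSet ((w.sgn : ℤ) : ℂ) := by
  simp [coord, mk]

theorem coord_v (S : NSubset n) :
    coord n S.v = Pi.single S.1 ((S.word.sgn : ℤ) : ℂ) := by
  rw [NSubset.v, coord_mk, S.innerSet_word]

theorem basis_apply (S : NSubset n) : basis n S = S.v := by simp [basis]

theorem coord_sum_smul_v (c : NSubset n → ℂ) (T : NSubset n) :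
    coord n (∑ S, c S • S.v) T.1 = c T * ((T.word.sgn : ℤ) : ℂ) := by
  simp only [map_sum, map_smul, coord_v, Finset.sum_apply, Pi.smul_apply, smul_eq_mul]
  rw [Finset.sum_eq_single T]
  · simp
  · intro S _ hS
    rw [Pi.single_eq_of_ne (fun h => hS (Subtype.ext h.symm)), mul_zero]
  · simp

theorem sgn_mul_self (w : BracketWord n) : ((w.sgn : ℤ) : ℂ) * ((w.sgn : ℤ) : ℂ) = 1 := by
  rcases Int.units_eq_one_or w.sgn with h | h <;> simp [h]

theorem coord_injective : Function.Injective (coord n) := by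
  rw [← LinearMap.ker_eq_bot, LinearMap.ker_eq_bot']
  intro x hx
  rw [← (basis n).sum_repr x]
  refine Finset.sum_eq_zero fun T _ => ?_
  have h1 := coord_sum_smul_v (fun S => (basis n).repr x S) T
  simp only [← basis_apply, (basis n).sum_repr x, hx, Pi.zero_apply] at h1
  have h2 : (basis n).repr x T = 0 := by
    have h3 := sgn_mul_self T.word
    have h4 : ((T.word.sgn : ℤ) : ℂ) ≠ 0 := left_ne_zero_of_mul (h3 ▸ one_ne_zero)
    exact (mul_eq_zero.1 h1.symm).resolve_right h4
  rw [h2, zero_smul]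

theorem linearMap_ext {M : Type*} [AddCommMonoid M] [Module ℂ M] {f g : V3 n →ₗ[ℂ] M}
    (h : ∀ S : NSubset n, f S.v = g S.v) : f = g :=
  (basis n).ext fun S => by rw [basis_apply, h]

theorem coord_eq_zero (x : V3 n) {S : Finset (Fin (2 * n - 1))} (hS : S.card ≠ n) :
    coord n x S = 0 := by
  have h : LinearMap.proj S ∘ₗ coord n = 0 := linearMap_ext fun T => by
    simp only [LinearMap.comp_apply, coord_v, LinearMap.proj_apply, LinearMap.zero_apply]
    rw [Pi.single_eq_of_ne]
    rintro rfl
    exact hS T.2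
  exact LinearMap.congr_fun h x

/-- The element of `V_{n,3}` given by a function on `n`-sets of letters. -/
def ofFun (F : Finset (Fin (2 * n - 1)) → ℂ) : V3 n :=
  ∑ S : NSubset n, (F S.1 * ((S.word.sgn : ℤ) : ℂ)) • S.v

theorem coord_ofFun (F : Finset (Fin (2 * n - 1)) → ℂ) {S : Finset (Fin (2 * n - 1))}
    (hS : S.card = n) : coord n (ofFun F) S = F S := by
  have h := coord_sum_smul_v (fun T => F T.1 * ((T.word.sgn : ℤ) : ℂ)) ⟨S, hS⟩
  rw [ofFun, h, mul_assoc, sgn_mul_self, mul_one]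

/-- In other words, V_{n,3} is the permutation module on n-sets tensored with the sign character. -/
theorem coord_rep (τ : Equiv.Perm (Fin (2 * n - 1))) (x : V3 n) (S : Finset (Fin (2 * n - 1))) :
    coord n (V3.rep n τ x) S =
      ((Equiv.Perm.sign τ : ℤ) : ℂ) * coord n x (S.map τ.symm.toEmbedding) := by
  have h : LinearMap.proj S ∘ₗ coord n ∘ₗ V3.rep n τ = ((Equiv.Perm.sign τ : ℤ) : ℂ) •
      (LinearMap.proj (S.map τ.symm.toEmbedding) ∘ₗ coord n) := linearMap_ext fun T => by
    simp only [LinearMap.comp_apply, NSubset.v, rep_mk, coord_mk, LinearMap.smul_apply,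
      LinearMap.proj_apply, BracketWord.sgn_relabel, BracketWord.innerSet_relabel, Pi.single_apply,
      smul_eq_mul]
    have h1 : S = T.word.innerSet.map τ.toEmbedding ↔
        S.map τ.symm.toEmbedding = T.word.innerSet := by
      constructor
      · rintro rfl
        ext x
        simp
      · intro h
        rw [← h]
        ext x
        simp
    simp only [h1]
    split_ifs <;> simp
  exact LinearMap.congr_fun h x

/-- The sets {a} ∪ Sᶜ with a ∈ S are the n-sets that meet S in exactly one letter. The minus sign in
R_S cancels the one in `NSubset.sgn_jacobiWord`. -/
theorem coord_jacobiMap (x : V3 n) (S : Finset (Fin (2 * n - 1))) :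
    coord n (jacobiMap n x) S = coord n x S + (-1) ^ n * ∑ a ∈ S, coord n x (insert a Sᶜ) := by
  have h : LinearMap.proj S ∘ₗ coord n ∘ₗ jacobiMap n = LinearMap.proj S ∘ₗ coord n +
      ((-1) ^ n : ℂ) • ∑ a ∈ S, LinearMap.proj (insert a Sᶜ) ∘ₗ coord n :=
    linearMap_ext fun T => by
    -- Meeting in the single letter a is a symmetric relation between n-sets, which transposes the
    -- matrix of φ.
    have key : ∑ i : Fin n, (if S = insert (T.a i) T.1ᶜ then (1 : ℂ) else 0) =
        ∑ a ∈ S, if insert a Sᶜ = T.1 then 1 else 0 := by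
      have h1 : ∑ i : Fin n, (if S = insert (T.a i) T.1ᶜ then (1 : ℂ) else 0) =
          ∑ a ∈ T.1, if S = insert a T.1ᶜ then 1 else 0 := by
        symm
        refine Finset.sum_bij_ne_zero (fun a ha _ => (T.exists_a_eq ha).choose)
          (fun _ _ _ => Finset.mem_univ _) ?_ ?_ ?_
        · intro a ha _ b hb _ hab
          rw [← (T.exists_a_eq ha).choose_spec, ← (T.exists_a_eq hb).choose_spec, hab]
        · intro i _ hi
          refine ⟨T.a i, T.a_mem i, hi, ?_⟩
          exact T.a.injective (T.exists_a_eq (T.a_mem i)).choose_spec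
        · intro a ha _
          rw [(T.exists_a_eq ha).choose_spec]
      rw [h1, ← Finset.sum_filter, ← Finset.sum_filter]
      congr 1
      ext a
      simp only [Finset.mem_filter]
      constructor
      · rintro ⟨ha, rfl⟩
        refine ⟨by simp, ?_⟩
        ext y
        by_cases hy : y = a
        · simp [hy, ha]
        · simp [hy]
      · rintro ⟨ha, h⟩
        rw [← h]
        refine ⟨by simp, ?_⟩
        ext y
        by_cases hy : y = a
        · simp [hy, ha]
        · simp [hy]
    have h2 : coord n (jacobiMap n T.v) S = ((T.word.sgn : ℤ) : ℂ) *
        ((if S = T.1 then 1 else 0) +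
          (-1) ^ n * ∑ i : Fin n, (if S = insert (T.a i) T.1ᶜ then (1 : ℂ) else 0)) := by
      rw [jacobiMap_v, NSubset.jacobiRelation, map_sub, coord_v, map_sum, Pi.sub_apply,
        Finset.sum_apply, mul_add, Finset.mul_sum, Finset.mul_sum, sub_eq_add_neg,
        ← Finset.sum_neg_distrib]
      congr 1
      · simp [Pi.single_apply]
      · refine Finset.sum_congr rfl fun i _ => ?_
        rw [coord_mk, NSubset.innerSet_jacobiWord, NSubset.sgn_jacobiWord, Pi.single_apply]
        split_ifs
        · push_cast
          ring
        · simp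
    simp only [LinearMap.comp_apply, LinearMap.proj_apply, LinearMap.add_apply,
      LinearMap.smul_apply, LinearMap.sum_apply, h2, key, coord_v, Pi.single_apply, smul_eq_mul]
    rw [mul_add, Finset.mul_sum, Finset.mul_sum, Finset.mul_sum]
    congr 1
    · simp
    · refine Finset.sum_congr rfl fun i _ => ?_
      split_ifs
      · ring
      · simp
  simpa using LinearMap.congr_fun h x

end V3
end

/-! ### Orbits on pairs of n-sets and the size of the commutant -/

noncomputable section

/-- Two pairs of finite sets are related by a permutation if the sets and their intersections have
the same cardinalities. -/
theorem Finset.exists_perm_map_eq_map_eq {α : Type*} [Fintype α] [DecidableEq α]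
    {S S' R R' : Finset α} (h : S.card = R.card) (h' : S'.card = R'.card)
    (hi : (S ∩ S').card = (R ∩ R').card) :
    ∃ τ : Equiv.Perm α, S.map τ.toEmbedding = R ∧ S'.map τ.toEmbedding = R' := by
  -- The four fibres are the regions of the Venn diagram. Their sizes agree for the two pairs, and
  -- bijections between them glue to the permutation `τ`.
  have key : ∀ c : Bool × Bool, Fintype.card {x // (decide (x ∈ S), decide (x ∈ S')) = c} =
      Fintype.card {x // (decide (x ∈ R), decide (x ∈ R')) = c} := by
    have h1 : ∀ (A B : Finset α) (c : Bool × Bool),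
        Fintype.card {x // (decide (x ∈ A), decide (x ∈ B)) = c} =
        (Finset.univ.filter fun x => (x ∈ A ↔ c.1) ∧ (x ∈ B ↔ c.2)).card := by
      intro A B c
      rw [Fintype.card_subtype]
      congr 1
      ext x
      rcases c with ⟨_ | _, _ | _⟩ <;> simp
    have h11 : ∀ A B : Finset α,
        (Finset.univ.filter fun x => (x ∈ A ↔ true) ∧ (x ∈ B ↔ true)) = A ∩ B := by
      intro A B; ext x; simp
    have h10 : ∀ A B : Finset α,
        (Finset.univ.filter fun x => (x ∈ A ↔ true) ∧ (x ∈ B ↔ false)) = A \ B := by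
      intro A B; ext x; simp
    have h01 : ∀ A B : Finset α,
        (Finset.univ.filter fun x => (x ∈ A ↔ false) ∧ (x ∈ B ↔ true)) = B \ A := by
      intro A B; ext x; simp [and_comm]
    have h00 : ∀ A B : Finset α,
        (Finset.univ.filter fun x => (x ∈ A ↔ false) ∧ (x ∈ B ↔ false)) = (A ∪ B)ᶜ := by
      intro A B; ext x; simp
    have e1 := Finset.card_sdiff_add_card_inter S S'
    have e2 := Finset.card_sdiff_add_card_inter R R'
    have e3 := Finset.card_sdiff_add_card_inter S' S
    have e4 := Finset.card_sdiff_add_card_inter R' R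
    have e5 := Finset.card_union_add_card_inter S S'
    have e6 := Finset.card_union_add_card_inter R R'
    rw [Finset.inter_comm] at e3 e4
    rintro ⟨_ | _, _ | _⟩ <;> rw [h1, h1]
    · rw [h00, h00, Finset.card_compl, Finset.card_compl]; omega
    · rw [h01, h01]; omega
    · rw [h10, h10]; omega
    · rw [h11, h11]; omega
  let τ : Equiv.Perm α := Equiv.ofFiberEquiv fun c => Fintype.equivOfCardEq (key c)
  have hτ : ∀ x, (decide (τ x ∈ R), decide (τ x ∈ R')) = (decide (x ∈ S), decide (x ∈ S')) :=
    fun x => Equiv.ofFiberEquiv_map (f := fun x => (decide (x ∈ S), decide (x ∈ S')))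
      (g := fun x => (decide (x ∈ R), decide (x ∈ R'))) _ x
  simp only [Prod.mk.injEq, decide_eq_decide] at hτ
  refine ⟨τ, ?_, ?_⟩
  · ext x
    rw [Finset.mem_map_equiv, ← (hτ _).1, Equiv.apply_symm_apply]
  · ext x
    rw [Finset.mem_map_equiv, ← (hτ _).2, Equiv.apply_symm_apply]

namespace V3

variable {n : ℕ} [NeZero n]

theorem ext_coord {x y : V3 n}
    (h : ∀ S : Finset (Fin (2 * n - 1)), S.card = n → coord n x S = coord n y S) : x = y := by
  apply coord_injective
  funext S
  by_cases hS : S.card = n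
  · exact h S hS
  · rw [coord_eq_zero x hS, coord_eq_zero y hS]

theorem rep_ofFun_single (τ : Equiv.Perm (Fin (2 * n - 1))) (S : Finset (Fin (2 * n - 1))) :
    V3.rep n τ (ofFun (Pi.single S 1)) = ((Equiv.Perm.sign τ : ℤ) : ℂ) •
      ofFun (Pi.single (S.map τ.toEmbedding) 1) := by
  refine ext_coord fun R hR => ?_
  rw [coord_rep, coord_ofFun _ (by simpa using hR), map_smul, Pi.smul_apply, coord_ofFun _ hR,
    smul_eq_mul, Pi.single_apply, Pi.single_apply]
  congr 1
  refine if_congr ?_ rfl rfl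
  constructor
  · rintro rfl
    ext x
    simp
  · rintro rfl
    ext x
    simp

/-- A pair of `n`-sets with `m + 1` common elements. -/
def setPair (n m : ℕ) : Finset (Fin (2 * n - 1)) × Finset (Fin (2 * n - 1)) :=
  Classical.epsilon fun p => p.1.card = n ∧ p.2.card = n ∧ (p.1 ∩ p.2).card = m + 1

/-- The matrix entries of an endomorphism at representatives of the orbits of `S_{2n-1}` on pairs
of `n`-sets. -/
def orbitEntries (n : ℕ) [NeZero n] : Module.End ℂ (V3 n) →ₗ[ℂ] (Fin n → ℂ) where
  toFun T m := coord n (T (ofFun (Pi.single (setPair n m).1 1))) (setPair n m).2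
  map_add' _ _ := by funext; simp
  map_smul' _ _ := by funext; simp

/-- Up to sign, the matrix entries of an equivariant endomorphism are constant on orbits of pairs of
n-sets, and `orbitEntries` samples every orbit. -/
theorem eq_zero_of_orbitEntries_eq_zero {T : Module.End ℂ (V3 n)}
    (hT : ∀ τ, T * V3.rep n τ = V3.rep n τ * T) (h : orbitEntries n T = 0) : T = 0 := by
  have key : ∀ S : Finset (Fin (2 * n - 1)), S.card = n → T (ofFun (Pi.single S 1)) = 0 := by
    intro S hS
    refine ext_coord fun S' hS' => ?_
    rw [map_zero, Pi.zero_apply]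
    have h1 := Finset.card_union_add_card_inter S S'
    have h2 := Finset.card_le_univ (S ∪ S')
    have h3 := Finset.card_le_card (Finset.inter_subset_left (s₁ := S) (s₂ := S'))
    have hn := NeZero.ne n
    rw [Fintype.card_fin] at h2
    -- Two n-sets among 2n-1 letters always meet, so there are n intersection sizes and not n + 1.
    obtain ⟨m, hm⟩ : ∃ m : Fin n, (S ∩ S').card = m + 1 :=
      ⟨⟨(S ∩ S').card - 1, by omega⟩, by simp only; omega⟩
    obtain ⟨g1, g2, g3⟩ : (setPair n m).1.card = n ∧ (setPair n m).2.card = n ∧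
        ((setPair n m).1 ∩ (setPair n m).2).card = m + 1 :=
      Classical.epsilon_spec (p := fun p : Finset (Fin (2 * n - 1)) × Finset (Fin (2 * n - 1)) =>
        p.1.card = n ∧ p.2.card = n ∧ (p.1 ∩ p.2).card = m + 1) ⟨(S, S'), hS, hS', hm⟩
    obtain ⟨τ, t1, t2⟩ := Finset.exists_perm_map_eq_map_eq (hS.trans g1.symm) (hS'.trans g2.symm)
      (hm.trans g3.symm)
    have h4 : coord n (T (ofFun (Pi.single (setPair n m).1 1))) (setPair n m).2 = 0 :=
      congrFun h m
    have h5 := congrArg (fun x => coord n x (setPair n m).2)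
      (LinearMap.congr_fun (hT τ) (ofFun (Pi.single S 1)))
    have h6 : (setPair n m).2.map τ.symm.toEmbedding = S' := by
      rw [← t2]
      ext x
      simp
    simp only [Module.End.mul_apply, rep_ofFun_single, map_smul, Pi.smul_apply, t1, h4, smul_zero,
      coord_rep, h6] at h5
    have h7 : ((Equiv.Perm.sign τ : ℤ) : ℂ) ≠ 0 := by
      rcases Int.units_eq_one_or (Equiv.Perm.sign τ) with h | h <;> simp [h]
    exact (mul_eq_zero.1 h5.symm).resolve_left h7
  refine linearMap_ext fun S => ?_
  have h1 : S.v = ((S.word.sgn : ℤ) : ℂ) • ofFun (Pi.single S.1 1) := by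
    refine ext_coord fun R hR => ?_
    rw [coord_v, map_smul, Pi.smul_apply, coord_ofFun _ hR, Pi.single_apply, Pi.single_apply]
    split_ifs <;> simp
  rw [h1, map_smul, key _ S.2, smul_zero, LinearMap.zero_apply]

/-- The coordinate formula for φ uses only complements and insertions, which commute with
relabelling. -/
theorem jacobiMap_mul_rep (τ : Equiv.Perm (Fin (2 * n - 1))) :
    jacobiMap n * V3.rep n τ = V3.rep n τ * jacobiMap n := by
  refine LinearMap.ext fun x => ?_
  refine ext_coord fun S _ => ?_
  have h1 : ∀ a ∈ S, coord n (V3.rep n τ x) (insert a Sᶜ) = ((Equiv.Perm.sign τ : ℤ) : ℂ) *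
      coord n x (insert (τ.symm a) (S.map τ.symm.toEmbedding)ᶜ) := by
    intro a _
    have h0 : Sᶜ.map τ.symm.toEmbedding = (S.map τ.symm.toEmbedding)ᶜ := by
      ext x
      simp
    rw [coord_rep, Finset.map_insert, h0]
    rfl
  simp only [Module.End.mul_apply]
  rw [coord_jacobiMap, coord_rep, Finset.sum_congr rfl h1, coord_rep, coord_jacobiMap,
    Finset.sum_map, ← Finset.mul_sum]
  simp only [Equiv.coe_toEmbedding]
  ring

end V3
end

/-! ### Functions on sets: Euler's identity and complements -/

noncomputable section

section SetFun

theorem Finset.map_perm_mul {α : Type*} (σ τ : Equiv.Perm α) (S : Finset α) :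
    S.map (σ * τ).toEmbedding = (S.map τ.toEmbedding).map σ.toEmbedding := by
  rw [Finset.map_map]
  rfl

variable {α : Type*} [Fintype α] [DecidableEq α]

/-- The action of the group algebra on the indicator function of `{B | Q ⊆ B}`, for the action of
permutations on functions on sets that is twisted by the sign. -/
def setFun (Q : Finset α) : ℂ[Equiv.Perm α] →ₗ[ℂ] (Finset α → ℂ) :=
  Finsupp.linearCombination ℂ (fun (g : Equiv.Perm α) (B : Finset α) =>
    ((Equiv.Perm.sign g : ℤ) : ℂ) * if Q.map g.toEmbedding ⊆ B then 1 else 0) ∘ₗ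
    (MonoidAlgebra.coeffLinearEquiv ℂ).toLinearMap

theorem setFun_single (Q : Finset α) (g : Equiv.Perm α) (c : ℂ) (B : Finset α) :
    setFun Q (MonoidAlgebra.single g c) B =
      c * (((Equiv.Perm.sign g : ℤ) : ℂ) * if Q.map g.toEmbedding ⊆ B then 1 else 0) := by
  simp [setFun]

theorem setFun_apply (Q : Finset α) (y : ℂ[Equiv.Perm α]) (B : Finset α) :
    setFun Q y B = ∑ g, y.coeff g *
      (((Equiv.Perm.sign g : ℤ) : ℂ) * if Q.map g.toEmbedding ⊆ B then 1 else 0) := by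
  rw [setFun, LinearMap.comp_apply, Finsupp.linearCombination_apply,
    Finsupp.sum_fintype _ _ (by simp), Finset.sum_apply]
  rfl

theorem setFun_leftRegular (Q : Finset α) (g : Equiv.Perm α) (y : ℂ[Equiv.Perm α])
    (B : Finset α) : setFun Q (Representation.leftRegular ℂ (Equiv.Perm α) g y) B =
      ((Equiv.Perm.sign g : ℤ) : ℂ) * setFun Q y (B.map g.symm.toEmbedding) := by
  induction y using MonoidAlgebra.induction_linear with
  | zero => simp
  | add x y hx hy => rw [map_add, map_add, map_add, Pi.add_apply, Pi.add_apply, hx, hy, mul_add]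
  | single h c =>
    rw [Representation.ofMulAction_single, setFun_single, setFun_single, smul_eq_mul,
      Finset.map_perm_mul, Equiv.Perm.sign_mul]
    have h1 : (Q.map h.toEmbedding).map g.toEmbedding ⊆ B ↔
        Q.map h.toEmbedding ⊆ B.map g.symm.toEmbedding := by
      constructor
      · intro H x hx
        rw [Finset.mem_map_equiv, Equiv.symm_symm]
        exact H (Finset.mem_map_of_mem _ hx)
      · intro H x hx
        rw [Finset.mem_map_equiv] at hx
        simpa using H hx
    rw [if_congr h1 rfl rfl]
    push_cast
    ring

/-- Euler's identity for the degree `#Q`. -/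
theorem sum_setFun_erase (Q : Finset α) (y : ℂ[Equiv.Perm α]) (B : Finset α) :
    ∑ a ∈ B, setFun Q y (B.erase a) = ((B.card : ℂ) - Q.card) * setFun Q y B := by
  induction y using MonoidAlgebra.induction_linear with
  | zero => simp
  | add x y hx hy => simp only [map_add, Pi.add_apply, Finset.sum_add_distrib, hx, hy, mul_add]
  | single g c =>
    simp only [setFun_single, ← Finset.mul_sum]
    have key : ∑ a ∈ B, (if Q.map g.toEmbedding ⊆ B.erase a then (1 : ℂ) else 0) =
        ((B.card : ℂ) - Q.card) * if Q.map g.toEmbedding ⊆ B then 1 else 0 := by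
      rw [← Finset.sum_filter, Finset.sum_const, nsmul_eq_mul, mul_one]
      split_ifs with h
      · have h1 : B.filter (fun a => Q.map g.toEmbedding ⊆ B.erase a) =
            B \ Q.map g.toEmbedding := by
          ext a
          simp only [Finset.mem_filter, Finset.mem_sdiff, Finset.subset_erase, h, true_and]
        rw [h1, Finset.card_sdiff_of_subset h, Nat.cast_sub (Finset.card_le_card h),
          Finset.card_map, mul_one]
      · rw [Finset.filter_false_of_mem, Finset.card_empty, Nat.cast_zero, mul_zero]
        exact fun a _ h' => h (h'.trans (Finset.erase_subset _ _))
    rw [key]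
    ring

/-- Euler's identity expresses (#B - #Q) F(B) by values on sets with one element less, and the
factor is nonzero once #B > k ≥ #Q. -/
theorem setFun_eq_zero_of_le {Q : Finset α} {y : ℂ[Equiv.Perm α]} {k : ℕ} (hk : Q.card ≤ k)
    (h : ∀ B : Finset α, B.card = k → setFun Q y B = 0) (B : Finset α) (hB : k ≤ B.card) :
    setFun Q y B = 0 := by
  induction hm : B.card using Nat.strong_induction_on generalizing B with
  | _ m ih =>
    rcases hB.eq_or_lt with hB' | hB'
    · exact h B hB'.symm
    · have h1 := sum_setFun_erase Q y B
      rw [Finset.sum_eq_zero] at h1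
      · refine (mul_eq_zero.1 h1.symm).resolve_left (sub_ne_zero.2 ?_)
        exact_mod_cast (hk.trans_lt hB').ne'
      · intro a ha
        have h2 := Finset.card_erase_of_mem ha
        exact ih _ (by omega) _ (by omega) rfl

/-- A function on sets that depends only on the intersection with a union of disjoint pairs
`{x, p x}` and that is antisymmetric under each transposition of a pair is symmetric or
antisymmetric under complements. -/
theorem compl_eq_neg_one_pow_mul {F : Finset α → ℂ} {Q : Finset α} {p : α → α}
    (hpQ : ∀ x ∈ Q, p x ∉ Q) (hp : Set.InjOn p Q)
    (hanti : ∀ x ∈ Q, ∀ B, F (B.map (Equiv.swap x (p x)).toEmbedding) = -F B)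
    (hdep : ∀ B B', (∀ x ∈ Q, (x ∈ B ↔ x ∈ B') ∧ (p x ∈ B ↔ p x ∈ B')) → F B = F B')
    (B : Finset α) : F Bᶜ = (-1) ^ Q.card * F B := by
  by_cases hQ : ∃ x ∈ Q, (x ∈ B ↔ p x ∈ B)
  · obtain ⟨x, hx, hxB⟩ := hQ
    -- The transposition of the pair fixes such a set, so F(A) = -F(A).
    have key : ∀ A : Finset α, (x ∈ A ↔ p x ∈ A) → F A = 0 := by
      intro A hA
      have h1 : A.map (Equiv.swap x (p x)).toEmbedding = A := by
        ext y
        rw [Finset.mem_map_equiv, Equiv.symm_swap]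
        by_cases h1 : y = x
        · rw [h1, Equiv.swap_apply_left, hA]
        · by_cases h2 : y = p x
          · rw [h2, Equiv.swap_apply_right, hA]
          · rw [Equiv.swap_apply_of_ne_of_ne h1 h2]
      have h2 := hanti x hx A
      rw [h1] at h2
      exact self_eq_neg.1 h2
    rw [key B hxB, key Bᶜ (by simpa using not_congr hxB), mul_zero]
  · push Not at hQ
    have hpart : ∀ x ∈ Q, (x ∈ B ↔ p x ∉ B) := by
      intro x hx
      rcases hQ x hx with h | h <;> tauto
    -- Now B contains exactly one letter of each pair, and flipping one pair is a transposition that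
    -- costs one sign. For J = Q the flipped set agrees with Bᶜ on all pairs.
    have key : ∀ J ⊆ Q, F (symmDiff B (J ∪ J.image p)) = (-1) ^ J.card * F B := by
      intro J
      induction J using Finset.induction_on with
      | empty =>
        intro _
        rw [Finset.image_empty, Finset.union_empty, Finset.card_empty, pow_zero, one_mul,
          ← Finset.bot_eq_empty, symmDiff_bot]
      | insert x J hxJ ih =>
        intro hJ
        have hx : x ∈ Q := hJ (Finset.mem_insert_self _ _)
        have hJQ : J ⊆ Q := (Finset.subset_insert _ _).trans hJ
        have hxp : x ∉ J.image p := by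
          rw [Finset.mem_image]
          rintro ⟨z, hz, hzx⟩
          exact hpQ z (hJQ hz) (hzx ▸ hx)
        have hpx : p x ∉ J := fun h => hpQ x hx (hJQ h)
        have hpxp : p x ∉ J.image p := by
          rw [Finset.mem_image]
          rintro ⟨z, hz, hzx⟩
          exact hxJ (hp (hJQ hz) hx hzx ▸ hz)
        have hne : p x ≠ x := fun h => hpQ x hx (h.symm ▸ hx)
        have hB := hpart x hx
        have h1 : symmDiff B (insert x J ∪ (insert x J).image p) =
            (symmDiff B (J ∪ J.image p)).map (Equiv.swap x (p x)).toEmbedding := by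
          ext y
          rw [Finset.mem_map_equiv, Equiv.symm_swap, Finset.image_insert]
          simp only [Finset.mem_symmDiff, Finset.mem_union, Finset.mem_insert]
          by_cases h1 : y = x
          · rw [h1, Equiv.swap_apply_left]
            tauto
          · by_cases h2 : y = p x
            · rw [h2, Equiv.swap_apply_right]
              tauto
            · rw [Equiv.swap_apply_of_ne_of_ne h1 h2]
              tauto
        rw [h1, hanti x hx, ih hJQ, Finset.card_insert_of_notMem hxJ, pow_succ]
        ring
    rw [← key Q subset_rfl]
    refine hdep _ _ fun x hx => ?_
    have h1 : p x ∈ Q.image p := Finset.mem_image_of_mem p hx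
    simp only [Finset.mem_symmDiff, Finset.mem_union, Finset.mem_compl]
    tauto

end SetFun

/-! ### Specht modules of two-column tableaux as functions on sets -/

namespace Tableau

variable {μ : YoungDiagram} {N : ℕ} (t : Tableau μ N)

theorem mem_rowStabilizer {σ : Equiv.Perm (Fin N)} :
    σ ∈ t.rowStabilizer ↔ ∀ x, (t.symm (σ x)).1.1 = (t.symm x).1.1 := by
  simp [rowStabilizer]

theorem mem_colStabilizer {σ : Equiv.Perm (Fin N)} :
    σ ∈ t.colStabilizer ↔ ∀ x, (t.symm (σ x)).1.2 = (t.symm x).1.2 := by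
  simp [colStabilizer]

theorem mul_mem_colStabilizer_iff {σ τ : Equiv.Perm (Fin N)} (hτ : τ ∈ t.colStabilizer) :
    σ * τ ∈ t.colStabilizer ↔ σ ∈ t.colStabilizer := by
  simp only [mem_colStabilizer, Equiv.Perm.mul_apply] at hτ ⊢
  constructor
  · intro h x
    have h1 := h (τ.symm x)
    have h2 := hτ (τ.symm x)
    rw [Equiv.apply_symm_apply] at h1 h2
    rw [h1, h2]
  · intro h x
    rw [h, hτ]

theorem mul_mem_rowStabilizer_iff {σ τ : Equiv.Perm (Fin N)} (hσ : σ ∈ t.rowStabilizer) :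
    σ * τ ∈ t.rowStabilizer ↔ τ ∈ t.rowStabilizer := by
  simp only [mem_rowStabilizer, Equiv.Perm.mul_apply] at hσ ⊢
  simp only [hσ]

/-- The letters of the second column. -/
def secondColumn : Finset (Fin N) := {x | (t.symm x).1.2 = 1}

theorem mem_secondColumn {x : Fin N} : x ∈ t.secondColumn ↔ (t.symm x).1.2 = 1 := by
  simp [secondColumn]

/-- The letter in the first column and in the row of `x`. -/
def rowLeader (x : Fin N) : Fin N :=
  t ⟨((t.symm x).1.1, 0), μ.up_left_mem le_rfl (Nat.zero_le _) (t.symm x).2⟩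

theorem symm_rowLeader (x : Fin N) : (t.symm (t.rowLeader x)).1 = ((t.symm x).1.1, 0) := by
  simp [rowLeader]

theorem rowLeader_notMem (x : Fin N) : t.rowLeader x ∉ t.secondColumn := by
  rw [mem_secondColumn, symm_rowLeader]
  exact zero_ne_one

theorem ext_cell {x y : Fin N} (h : (t.symm x).1 = (t.symm y).1) : x = y :=
  t.symm.injective (Subtype.ext h)

theorem rowLeader_injOn : Set.InjOn t.rowLeader t.secondColumn := by
  intro x hx y hy h
  have h1 := congrArg (fun z => (t.symm z).1.1) h
  simp only [symm_rowLeader] at h1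
  exact t.ext_cell (Prod.ext h1 ((t.mem_secondColumn.1 hx).trans (t.mem_secondColumn.1 hy).symm))

theorem swap_rowLeader_mem (x : Fin N) : Equiv.swap x (t.rowLeader x) ∈ t.rowStabilizer := by
  rw [mem_rowStabilizer]
  intro y
  by_cases h1 : y = x
  · rw [h1, Equiv.swap_apply_left, symm_rowLeader]
  · by_cases h2 : y = t.rowLeader x
    · rw [h2, Equiv.swap_apply_right, symm_rowLeader]
    · rw [Equiv.swap_apply_of_ne_of_ne h1 h2]

theorem map_secondColumn_of_mem_colStabilizer {σ : Equiv.Perm (Fin N)}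
    (hσ : σ ∈ t.colStabilizer) : t.secondColumn.map σ.toEmbedding = t.secondColumn := by
  rw [mem_colStabilizer] at hσ
  ext x
  have h := hσ (σ.symm x)
  rw [Equiv.apply_symm_apply] at h
  rw [Finset.mem_map_equiv, mem_secondColumn, mem_secondColumn, h]

section TwoColumns

variable (hμ : ∀ c ∈ μ.cells, c.2 = 0 ∨ c.2 = 1)
include hμ

/-- The first column is the complement of the second, so it is preserved as well. -/
theorem mem_colStabilizer_of_map_secondColumn {σ : Equiv.Perm (Fin N)}
    (hσ : t.secondColumn.map σ.toEmbedding = t.secondColumn) : σ ∈ t.colStabilizer := by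
  rw [mem_colStabilizer]
  intro x
  have h1 : σ x ∈ t.secondColumn ↔ x ∈ t.secondColumn := by
    conv_lhs => rw [← hσ]
    simp
  rw [mem_secondColumn, mem_secondColumn] at h1
  rcases hμ _ (t.symm x).2 with h | h <;> rcases hμ _ (t.symm (σ x)).2 with h' | h' <;>
    simp_all

theorem eq_one_of_map_subset {σ : Equiv.Perm (Fin N)} (hr : σ ∈ t.rowStabilizer)
    (hσ : t.secondColumn.map σ.toEmbedding ⊆ t.secondColumn) : σ = 1 := by
  have hc := t.mem_colStabilizer_of_map_secondColumn hμ
    (Finset.eq_of_subset_of_card_le hσ (by rw [Finset.card_map]))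
  rw [mem_colStabilizer] at hc
  rw [mem_rowStabilizer] at hr
  ext1 x
  exact t.ext_cell (Prod.ext (hr x) (hc x))

end TwoColumns

/-- The row symmetrizer `∑_{α ∈ R_t} α`. -/
def rowSum : ℂ[Equiv.Perm (Fin N)] := ∑ α ∈ t.rowStabilizer, MonoidAlgebra.single α 1

/-- The column antisymmetrizer `∑_{β ∈ C_t} sgn(β) β`. -/
def colSum : ℂ[Equiv.Perm (Fin N)] :=
  ∑ β ∈ t.colStabilizer, MonoidAlgebra.single β ((Equiv.Perm.sign β : ℤ) : ℂ)

theorem youngSymmetrizer_eq : t.youngSymmetrizer = t.rowSum * t.colSum := rfl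

theorem colSum_mul_single {β : Equiv.Perm (Fin N)} (hβ : β ∈ t.colStabilizer) :
    t.colSum * MonoidAlgebra.single β 1 = ((Equiv.Perm.sign β : ℤ) : ℂ) • t.colSum := by
  rw [colSum, Finset.sum_mul, Finset.smul_sum]
  refine Finset.sum_equiv (Equiv.mulRight β) (fun σ => ?_) (fun σ _ => ?_)
  · rw [Equiv.coe_mulRight, mul_mem_colStabilizer_iff t hβ]
  · rw [Equiv.coe_mulRight, MonoidAlgebra.single_mul_single, mul_one, MonoidAlgebra.smul_single,
      Equiv.Perm.sign_mul]
    rcases Int.units_eq_one_or (Equiv.Perm.sign β) with h | h <;> simp [h]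

theorem leftRegular_rowSum {α : Equiv.Perm (Fin N)} (hα : α ∈ t.rowStabilizer) :
    Representation.leftRegular ℂ (Equiv.Perm (Fin N)) α t.rowSum = t.rowSum := by
  rw [rowSum, map_sum]
  refine Finset.sum_equiv (Equiv.mulLeft α) (fun σ => ?_) (fun σ _ => ?_)
  · rw [Equiv.coe_mulLeft, mul_mem_rowStabilizer_iff t hα]
  · rw [Equiv.coe_mulLeft, Representation.ofMulAction_single, smul_eq_mul]

/-- Column permutations fix the second column as a set, and the sign twist in `setFun` cancels their
signs, so all terms of the antisymmetrizer contribute equally. -/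
theorem setFun_mul_colSum (y : ℂ[Equiv.Perm (Fin N)]) :
    setFun t.secondColumn (y * t.colSum) =
      (t.colStabilizer.card : ℂ) • setFun t.secondColumn y := by
  induction y using MonoidAlgebra.induction_linear with
  | zero => simp
  | add x y hx hy => rw [add_mul, map_add, map_add, hx, hy, smul_add]
  | single g c =>
    funext B
    rw [colSum, Finset.mul_sum, map_sum, Finset.sum_apply, Pi.smul_apply, smul_eq_mul,
      ← nsmul_eq_mul, ← Finset.sum_const]
    refine Finset.sum_congr rfl fun β hβ => ?_
    rw [MonoidAlgebra.single_mul_single, setFun_single, setFun_single, Finset.map_perm_mul,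
      map_secondColumn_of_mem_colStabilizer t hβ, Equiv.Perm.sign_mul]
    rcases Int.units_eq_one_or (Equiv.Perm.sign β) with h | h <;> simp [h]

theorem setFun_youngSymmetrizer : setFun t.secondColumn t.youngSymmetrizer =
    (t.colStabilizer.card : ℂ) • setFun t.secondColumn t.rowSum :=
  t.setFun_mul_colSum _

theorem setFun_rowSum_apply (B : Finset (Fin N)) : setFun t.secondColumn t.rowSum B =
    ∑ α ∈ t.rowStabilizer, ((Equiv.Perm.sign α : ℤ) : ℂ) *
      if t.secondColumn.map α.toEmbedding ⊆ B then 1 else 0 := by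
  simp [rowSum, setFun_single]

theorem card_colStabilizer_ne_zero : (t.colStabilizer.card : ℂ) ≠ 0 := by
  rw [Nat.cast_ne_zero, Finset.card_ne_zero]
  exact ⟨1, by simp [mem_colStabilizer]⟩

/-- The column antisymmetrizer is the right factor of e_t, and left translation commutes with right
multiplication. -/
theorem coeff_mul_of_mem_specht {y : ℂ[Equiv.Perm (Fin N)]} (hy : y ∈ t.specht.toSubmodule)
    {β : Equiv.Perm (Fin N)} (hβ : β ∈ t.colStabilizer) (g : Equiv.Perm (Fin N)) :
    y.coeff (g * β) = ((Equiv.Perm.sign β : ℤ) : ℂ) * y.coeff g := by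
  induction hy using Submodule.span_induction generalizing g with
  | mem x h =>
    obtain ⟨τ, rfl⟩ := h
    simp only [Representation.coeff_ofMulAction, smul_eq_mul, ← mul_assoc]
    generalize τ⁻¹ * g = g
    have h1 : t.youngSymmetrizer * MonoidAlgebra.single β 1 =
        ((Equiv.Perm.sign β : ℤ) : ℂ) • t.youngSymmetrizer := by
      rw [youngSymmetrizer_eq, mul_assoc, colSum_mul_single t hβ, mul_smul_comm]
    have h2 := congrArg (fun z => z.coeff (g * β)) h1
    simp only [MonoidAlgebra.coeff_mul_single_apply, mul_inv_cancel_right, mul_one,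
      MonoidAlgebra.coeff_smul_apply, smul_eq_mul] at h2
    rw [h2, ← mul_assoc]
    rcases Int.units_eq_one_or (Equiv.Perm.sign β) with h | h <;> simp [h]
  | zero => simp
  | add x y _ _ hx hy => simp only [MonoidAlgebra.coeff_add, Finsupp.add_apply, hx, hy, mul_add]
  | smul c x _ hx =>
    simp only [MonoidAlgebra.coeff_smul_apply, hx, smul_eq_mul]
    ring

section TwoColumns

variable (hμ : ∀ c ∈ μ.cells, c.2 = 0 ∨ c.2 = 1)
include hμ

/-- Only the identity of R_t maps the second column into itself. This is what shows that e_t ≠ 0. -/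
theorem setFun_rowSum_secondColumn : setFun t.secondColumn t.rowSum t.secondColumn = 1 := by
  rw [setFun_rowSum_apply, Finset.sum_eq_single 1]
  · rw [if_pos (t.map_secondColumn_of_mem_colStabilizer (by simp [mem_colStabilizer])).subset]
    simp
  · intro α hα hne
    rw [if_neg fun h => hne (t.eq_one_of_map_subset hμ hα h), mul_zero]
  · intro h
    exact absurd (by simp [mem_rowStabilizer]) h

theorem youngSymmetrizer_ne_zero : t.youngSymmetrizer ≠ 0 := by
  intro h
  have h1 := congrFun t.setFun_youngSymmetrizer t.secondColumn
  rw [h, map_zero, Pi.smul_apply, setFun_rowSum_secondColumn t hμ, smul_eq_mul, mul_one] at h1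
  exact t.card_colStabilizer_ne_zero h1.symm

/-- The function is ∏ ([x ∈ B] - [x' ∈ B]) over the rows {x', x} of length two, and complementing B
negates every factor. The product is not written out: its antisymmetry comes from the invariance of
the row sum under row transpositions, the action being twisted by the sign. -/
theorem setFun_rowSum_compl (B : Finset (Fin N)) : setFun t.secondColumn t.rowSum Bᶜ =
    (-1) ^ t.secondColumn.card * setFun t.secondColumn t.rowSum B := by
  refine compl_eq_neg_one_pow_mul (p := t.rowLeader) (fun x _ => t.rowLeader_notMem x)
    t.rowLeader_injOn ?_ ?_ B
  · intro x hx B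
    have h1 := setFun_leftRegular t.secondColumn (Equiv.swap x (t.rowLeader x)) t.rowSum B
    rw [leftRegular_rowSum t (t.swap_rowLeader_mem x), Equiv.symm_swap, Equiv.Perm.sign_swap] at h1
    · rw [h1]
      simp
    · intro h
      exact t.rowLeader_notMem x (h ▸ hx)
  · intro B B' h
    rw [setFun_rowSum_apply, setFun_rowSum_apply]
    refine Finset.sum_congr rfl fun α hα => ?_
    congr 1
    refine if_congr ?_ rfl rfl
    have hsub : ∀ y ∈ t.secondColumn.map α.toEmbedding, (y ∈ B ↔ y ∈ B') := by
      intro y hy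
      rw [Finset.mem_map_equiv] at hy
      have hrow := t.mem_rowStabilizer.1 hα (α.symm y)
      rw [Equiv.apply_symm_apply] at hrow
      rcases hμ _ (t.symm y).2 with hc | hc
      · have hy' : y = t.rowLeader (α.symm y) := by
          apply t.ext_cell
          rw [symm_rowLeader]
          exact Prod.ext hrow hc
        rw [hy']
        exact (h _ hy).2
      · exact (h y (t.mem_secondColumn.2 hc)).1
    exact forall₂_congr hsub

/-- The identity passes from e_t to its translates because permutations commute with complements. -/
theorem setFun_compl {y : ℂ[Equiv.Perm (Fin N)]} (hy : y ∈ t.specht.toSubmodule)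
    (B : Finset (Fin N)) : setFun t.secondColumn y Bᶜ =
      (-1) ^ t.secondColumn.card * setFun t.secondColumn y B := by
  induction hy using Submodule.span_induction generalizing B with
  | mem x h =>
    obtain ⟨τ, rfl⟩ := h
    simp only
    have h1 : Bᶜ.map τ.symm.toEmbedding = (B.map τ.symm.toEmbedding)ᶜ := by
      ext x
      simp
    rw [setFun_leftRegular, setFun_leftRegular, h1, setFun_youngSymmetrizer, Pi.smul_apply,
      Pi.smul_apply, setFun_rowSum_compl t hμ, smul_eq_mul, smul_eq_mul]
    ring
  | zero => simp
  | add x y _ _ hx hy => simp only [map_add, Pi.add_apply, hx, hy, mul_add]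
  | smul c x _ hx =>
    simp only [map_smul, Pi.smul_apply, hx, smul_eq_mul]
    ring

/-- At the image of the second column under τ only the permutations in τ C_t contribute, and column
antisymmetry makes their contributions equal. The value is #C_t · sgn(τ) times the coefficient of y
at τ. -/
theorem eq_zero_of_setFun_eq_zero {y : ℂ[Equiv.Perm (Fin N)]} (hy : y ∈ t.specht.toSubmodule)
    (h : ∀ B : Finset (Fin N), B.card = t.secondColumn.card → setFun t.secondColumn y B = 0) :
    y = 0 := by
  ext τ
  have h1 := h (t.secondColumn.map τ.toEmbedding) (Finset.card_map _)
  rw [setFun_apply, ← Equiv.sum_comp (Equiv.mulLeft τ)] at h1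
  have h2 : ∀ β : Equiv.Perm (Fin N), y.coeff (τ * β) * (((Equiv.Perm.sign (τ * β) : ℤ) : ℂ) *
      if t.secondColumn.map (τ * β).toEmbedding ⊆ t.secondColumn.map τ.toEmbedding then 1 else 0) =
      if β ∈ t.colStabilizer then ((Equiv.Perm.sign τ : ℤ) : ℂ) * y.coeff τ else 0 := by
    intro β
    have hiff : t.secondColumn.map (τ * β).toEmbedding ⊆ t.secondColumn.map τ.toEmbedding ↔
        t.secondColumn.map β.toEmbedding ⊆ t.secondColumn := by
      rw [Finset.map_perm_mul, Finset.map_subset_map]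
    rw [if_congr hiff rfl rfl]
    by_cases hβ : β ∈ t.colStabilizer
    · rw [if_pos hβ, if_pos (t.map_secondColumn_of_mem_colStabilizer hβ).subset,
        coeff_mul_of_mem_specht t hy hβ, Equiv.Perm.sign_mul]
      rcases Int.units_eq_one_or (Equiv.Perm.sign β) with h | h <;> simp [h, mul_comm]
    · rw [if_neg hβ, if_neg, mul_zero, mul_zero]
      intro hsub
      exact hβ (t.mem_colStabilizer_of_map_secondColumn hμ
        (Finset.eq_of_subset_of_card_le hsub (by rw [Finset.card_map])))
  replace h1 := (Finset.sum_congr rfl fun β _ => (h2 β).symm).trans h1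
  rw [Finset.sum_ite_mem, Finset.univ_inter,
    Finset.sum_const, nsmul_eq_mul] at h1
  have h3 := (mul_eq_zero.1 h1).resolve_left t.card_colStabilizer_ne_zero
  refine (mul_eq_zero.1 h3).resolve_left ?_
  rcases Int.units_eq_one_or (Equiv.Perm.sign τ) with h | h <;> simp [h]

end TwoColumns

end Tableau

end

/-! ### Embedding the Specht modules into V_{n,3} -/

noncomputable section

section TwoColumnShape

theorem twoColumnShape_snd {n i : ℕ} : ∀ c ∈ (twoColumnShape n i).cells, c.2 = 0 ∨ c.2 = 1 := by
  intro c hc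
  rw [YoungDiagram.mem_cells, twoColumnShape, YoungDiagram.mem_ofRowLens] at hc
  obtain ⟨h1, h2⟩ := hc
  rw [List.getElem_append] at h2
  split_ifs at h2 <;> rw [List.getElem_replicate] at h2 <;> omega

theorem mk_one_mem_twoColumnShape {n i r : ℕ} :
    (r, 1) ∈ (twoColumnShape n i).cells ↔ r < i := by
  rw [YoungDiagram.mem_cells, twoColumnShape, YoungDiagram.mem_ofRowLens]
  constructor
  · rintro ⟨h1, h2⟩
    rw [List.getElem_append] at h2
    split_ifs at h2 with h
    · simpa using h
    · rw [List.getElem_replicate] at h2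
      exact absurd h2 (lt_irrefl _)
  · intro h
    refine ⟨by simp only [List.length_append, List.length_replicate]; omega, ?_⟩
    rw [List.getElem_append_left (by simpa using h), List.getElem_replicate]
    exact one_lt_two

theorem Tableau.card_secondColumn {n i N : ℕ} (t : Tableau (twoColumnShape n i) N) :
    t.secondColumn.card = i := by
  refine Eq.trans ?_ (Finset.card_range i)
  refine Finset.card_bij (fun x _ => (t.symm x).1.1) ?_ ?_ ?_
  · intro x hx
    rw [Finset.mem_range, ← mk_one_mem_twoColumnShape (n := n), ← t.mem_secondColumn.1 hx]
    exact (t.symm x).2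
  · intro x hx y hy h
    exact t.ext_cell
      (Prod.ext h ((t.mem_secondColumn.1 hx).trans (t.mem_secondColumn.1 hy).symm))
  · intro r hr
    refine ⟨t ⟨(r, 1), mk_one_mem_twoColumnShape.2 (Finset.mem_range.1 hr)⟩, ?_, by simp⟩
    simp [Tableau.mem_secondColumn]

end TwoColumnShape

namespace V3

variable {n : ℕ} [NeZero n]

/-- The embedding of the Specht module of a two-column tableau into `V_{n,3}`. -/
def ofSpecht {μ : YoungDiagram} (t : Tableau μ (2 * n - 1)) :
    t.spechtRep.IntertwiningMap (V3.rep n) where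
  toFun y := ofFun (setFun t.secondColumn y.1)
  map_add' x y := ext_coord fun S hS => by simp [coord_ofFun _ hS]
  map_smul' c x := ext_coord fun S hS => by simp [coord_ofFun _ hS]
  isIntertwining' g := LinearMap.ext fun y => ext_coord fun S hS => by
    have h1 : coord n (V3.rep n g (ofFun (setFun t.secondColumn y.1))) S =
        ((Equiv.Perm.sign g : ℤ) : ℂ) * setFun t.secondColumn y.1 (S.map g.symm.toEmbedding) := by
      rw [coord_rep, coord_ofFun _ (by simpa using hS)]
    refine Eq.trans ?_ h1.symm
    rw [← setFun_leftRegular]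
    exact coord_ofFun _ hS

theorem ofSpecht_apply {μ : YoungDiagram} (t : Tableau μ (2 * n - 1)) (y) :
    (ofSpecht t).toLinearMap y = ofFun (setFun t.secondColumn y.1) := rfl

/-- A function vanishing on n-sets vanishes on all larger sets by Euler's identity. The complement
of an i-set has 2n-1-i ≥ n letters, so by complement symmetry the function vanishes on i-sets, which
determine y. -/
theorem ofSpecht_injective (i : Fin n) (t : Tableau (twoColumnShape n i) (2 * n - 1)) :
    Function.Injective (ofSpecht t).toLinearMap := by
  rw [← LinearMap.ker_eq_bot, LinearMap.ker_eq_bot']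
  intro y hy
  have hi := i.isLt
  have hQ := t.card_secondColumn
  have h1 : ∀ B : Finset (Fin (2 * n - 1)), B.card = n → setFun t.secondColumn y.1 B = 0 := by
    intro B hB
    rw [← coord_ofFun (setFun t.secondColumn y.1) hB, ← ofSpecht_apply, hy, map_zero, Pi.zero_apply]
  refine Subtype.ext (t.eq_zero_of_setFun_eq_zero twoColumnShape_snd y.2 fun B hB => ?_)
  have h2 := setFun_eq_zero_of_le (by omega) h1 Bᶜ
    (by rw [Finset.card_compl, Fintype.card_fin]; omega)
  rw [t.setFun_compl twoColumnShape_snd y.2] at h2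
  exact (mul_eq_zero.1 h2).resolve_left (pow_ne_zero _ (neg_ne_zero.2 one_ne_zero))

/-- Since {a} ∪ Sᶜ is the complement of S \ a, complement symmetry contributes (-1)^i and Euler's
identity contributes n - i. -/
theorem jacobiMap_ofSpecht (i : Fin n) (t : Tableau (twoColumnShape n i) (2 * n - 1)) (y) :
    jacobiMap n ((ofSpecht t).toLinearMap y) =
      (1 + ((n : ℂ) - (i : ℕ)) * (-1) ^ (n - (i : ℕ))) • (ofSpecht t).toLinearMap y := by
  refine ext_coord fun S hS => ?_
  have h1 : ∀ a ∈ S, coord n ((ofSpecht t).toLinearMap y) (insert a Sᶜ) =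
      (-1) ^ (i : ℕ) * setFun t.secondColumn y.1 (S.erase a) := by
    intro a ha
    have hc : (insert a Sᶜ).card = n := by
      rw [Finset.card_insert_of_notMem (by simpa using ha), Finset.card_compl, hS,
        Fintype.card_fin]
      have := NeZero.ne n
      omega
    have h2 := t.setFun_compl twoColumnShape_snd y.2 (S.erase a)
    rw [Finset.compl_erase, t.card_secondColumn] at h2
    rw [ofSpecht_apply, coord_ofFun _ hc, h2]
  have h3 : ((-1) ^ n * (-1) ^ (i : ℕ) : ℂ) = (-1) ^ (n - (i : ℕ)) := by
    rw [← pow_add, show n + (i : ℕ) = n - i + 2 * i by omega, pow_add, pow_mul]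
    simp
  rw [coord_jacobiMap, Finset.sum_congr rfl h1, ← Finset.mul_sum, sum_setFun_erase, hS,
    t.card_secondColumn, map_smul, Pi.smul_apply, smul_eq_mul, ofSpecht_apply,
    coord_ofFun _ hS, ← h3]
  ring

end V3

/-! ### Induction from the Young subgroup -/

section Induced

variable (n : ℕ)

/-- The splitting of the letters into the first `n` and the last `n - 1`. -/
def letterSplit : Fin n ⊕ Fin (n - 1) ≃ Fin (2 * n - 1) :=
  finSumFinEquiv.trans (finCongr (by omega))

theorem youngSubgroupHom_apply (g : Equiv.Perm (Fin n) × Equiv.Perm (Fin (n - 1))) :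
    youngSubgroupHom n g = (letterSplit n).permCongr (Equiv.Perm.sumCongr g.1 g.2) := rfl

theorem sign_youngSubgroupHom (g : Equiv.Perm (Fin n) × Equiv.Perm (Fin (n - 1))) :
    Equiv.Perm.sign (youngSubgroupHom n g) = Equiv.Perm.sign g.1 * Equiv.Perm.sign g.2 := by
  rw [youngSubgroupHom_apply, Equiv.Perm.sign_permCongr, Equiv.Perm.sign_sumCongr]

/-- The set of the first `n` letters. -/
def firstLetters : Finset (Fin (2 * n - 1)) :=
  Finset.univ.map (Function.Embedding.inl.trans (letterSplit n).toEmbedding)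

theorem card_firstLetters : (firstLetters n).card = n := by simp [firstLetters]

theorem mem_firstLetters {x : Fin (2 * n - 1)} :
    x ∈ firstLetters n ↔ (letterSplit n).symm x ∈ Set.range Sum.inl := by
  simp [firstLetters, Equiv.eq_symm_apply]

/-- Cosets of the Young subgroup thereby correspond to n-sets, that is, to the basis v_S. -/
theorem map_firstLetters_iff {τ : Equiv.Perm (Fin (2 * n - 1))} :
    (firstLetters n).map τ.toEmbedding = firstLetters n ↔
      τ ∈ (youngSubgroupHom n).range := by
  constructor
  · intro h
    have hp : Set.MapsTo ((letterSplit n).symm.permCongr τ) (Set.range Sum.inl)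
        (Set.range Sum.inl) := by
      rintro _ ⟨j, rfl⟩
      rw [Equiv.permCongr_apply, Equiv.symm_symm, ← mem_firstLetters]
      rw [← h]
      refine Finset.mem_map_of_mem _ ((mem_firstLetters n).2 ?_)
      simp
    obtain ⟨g, hg⟩ := Equiv.Perm.mem_sumCongrHom_range_of_perm_mapsTo_inl hp
    refine ⟨g, ?_⟩
    have hg' : Equiv.Perm.sumCongr g.1 g.2 = (letterSplit n).symm.permCongr τ := hg
    rw [youngSubgroupHom_apply, hg']
    ext x
    simp [Equiv.permCongr_apply]
  · rintro ⟨g, rfl⟩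
    refine Finset.eq_of_subset_of_card_le ?_ (by rw [Finset.card_map])
    intro x hx
    obtain ⟨y, hy, rfl⟩ := Finset.mem_map.1 hx
    obtain ⟨j, hj⟩ := (mem_firstLetters n).1 hy
    rw [mem_firstLetters]
    refine ⟨g.1 j, ?_⟩
    simp [youngSubgroupHom_apply, Equiv.permCongr_apply, ← hj]

variable [NeZero n]

/-- The generator `[[1, …, n], n + 1, …, 2n - 1]`, up to sign. -/
def V3.gen : V3 n := V3.ofFun (Pi.single (firstLetters n) 1)

/-- The two signs cancel. This is the invariance that lets `V3.ofInd` descend to coinvariants. -/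
theorem V3.rep_youngSubgroupHom_gen (g : Equiv.Perm (Fin n) × Equiv.Perm (Fin (n - 1))) (c : ℂ) :
    V3.rep n (youngSubgroupHom n g) (signRep n g c • V3.gen n) = c • V3.gen n := by
  rw [map_smul, V3.gen, V3.rep_ofFun_single, (map_firstLetters_iff n).2 ⟨g, rfl⟩, smul_smul,
    sign_youngSubgroupHom]
  congr 1
  simp only [signRep, MonoidHom.coe_mk, OneHom.coe_mk, LinearMap.smul_apply, LinearMap.id_apply,
    smul_eq_mul]
  rcases Int.units_eq_one_or (Equiv.Perm.sign g.1) with h | h <;>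
  rcases Int.units_eq_one_or (Equiv.Perm.sign g.2) with h' | h' <;> simp [h, h']

/-- The map from the induced module given by the generator. -/
def V3.ofInd : Representation.IndV (youngSubgroupHom n) (signRep n) →ₗ[ℂ] V3 n :=
  Representation.Coinvariants.lift _
    (TensorProduct.lift <| (Finsupp.lift _ _ _ fun h =>
      V3.rep n h⁻¹ ∘ₗ LinearMap.toSpanSingleton ℂ (V3 n) (V3.gen n)) ∘ₗ
      (MonoidAlgebra.coeffLinearEquiv ℂ).toLinearMap)
    fun g => by
      ext h
      have h1 := V3.rep_youngSubgroupHom_gen n g⁻¹ (signRep n g 1)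
      have h2 : signRep n g⁻¹ (signRep n g 1) = 1 := by
        rw [← Module.End.mul_apply, ← map_mul, inv_mul_cancel, MonoidHom.map_one]
        rfl
      have h3 : signRep n g 1 * signRep n g 1 = 1 := by
        rcases Int.units_eq_one_or (Equiv.Perm.sign g.1) with h | h <;>
        rcases Int.units_eq_one_or (Equiv.Perm.sign g.2) with h' | h' <;> simp [signRep, h, h']
      rw [h2, one_smul, map_inv] at h1
      simp [h1, smul_smul, h3]

theorem V3.ofInd_mk (h : Equiv.Perm (Fin (2 * n - 1))) (c : ℂ) :
    V3.ofInd n (Representation.IndV.mk _ _ h c) = c • V3.rep n h⁻¹ (V3.gen n) := by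
  simp [V3.ofInd]

theorem V3.exists_smul_rep_gen (S : NSubset n) :
    ∃ (τ : Equiv.Perm (Fin (2 * n - 1))) (c : ℂ),
      (firstLetters n).map τ.toEmbedding = S.1 ∧ S.v = c • V3.rep n τ (V3.gen n) := by
  obtain ⟨τ, hτ, -⟩ := Finset.exists_perm_map_eq_map_eq (S := firstLetters n) (R := S.1)
    (S' := firstLetters n) (R' := S.1) ((card_firstLetters n).trans S.2.symm)
    ((card_firstLetters n).trans S.2.symm)
    (by rw [Finset.inter_self, Finset.inter_self, card_firstLetters, S.2])
  refine ⟨τ, ((S.word.sgn : ℤ) : ℂ) * ((Equiv.Perm.sign τ : ℤ) : ℂ), hτ,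
    V3.ext_coord fun R hR => ?_⟩
  rw [V3.gen, V3.rep_ofFun_single, hτ, V3.coord_v, map_smul, map_smul, Pi.smul_apply,
    Pi.smul_apply, V3.coord_ofFun _ hR, Pi.single_apply, Pi.single_apply]
  rcases Int.units_eq_one_or (Equiv.Perm.sign τ) with h | h <;> simp [h]

theorem V3.ofInd_surjective : Function.Surjective (V3.ofInd n) := by
  rw [← LinearMap.range_eq_top, eq_top_iff]
  refine V3.span_v.trans (Submodule.span_le.2 ?_)
  rintro _ ⟨S, rfl⟩
  obtain ⟨τ, c, -, h⟩ := V3.exists_smul_rep_gen n S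
  exact ⟨Representation.IndV.mk _ _ τ⁻¹ c, by rw [V3.ofInd_mk, inv_inv]; exact h.symm⟩

theorem Representation.IndV.mk_hom_mul {k G H A : Type*} [CommRing k] [Group G] [Group H]
    (φ : G →* H) [AddCommGroup A] [Module k A] (ρ : Representation k G A) (g : G) (h : H) (a : A) :
    Representation.IndV.mk φ ρ (φ g * h) (ρ g a) = Representation.IndV.mk φ ρ h a := by
  have h1 := Representation.Coinvariants.mk_self_apply
    (Representation.tprod ((Representation.leftRegular k H).comp φ) ρ) g
    (TensorProduct.tmul k (MonoidAlgebra.single h 1) a)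
  simpa using h1

/-- The dimension of the induced module is not computed. A surjection Θ from V_{n,3} onto it makes
`V3.ofInd` ∘ Θ a surjective endomorphism of a finite-dimensional space, hence injective. -/
theorem V3.ofInd_injective : Function.Injective (V3.ofInd n) := by
  choose τ c hτ _ using V3.exists_smul_rep_gen n
  let Θ : V3 n →ₗ[ℂ] Representation.IndV (youngSubgroupHom n) (signRep n) :=
    (V3.basis n).constr ℂ fun S => Representation.IndV.mk _ _ (τ S)⁻¹ 1
  have hΘ : Function.Surjective Θ := by
    rw [← LinearMap.range_eq_top, eq_top_iff]
    have key : ∀ h a, Representation.IndV.mk (youngSubgroupHom n) (signRep n) h a ∈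
        LinearMap.range Θ := by
      intro h a
      -- With this S the product `h * τ S` stabilizes the first n letters, so `h` lies in the Young
      -- coset of `(τ S)⁻¹`.
      let S : NSubset n := ⟨(firstLetters n).map (h⁻¹).toEmbedding,
        by rw [Finset.card_map, card_firstLetters]⟩
      have hS : (firstLetters n).map ((h * τ S)).toEmbedding = firstLetters n := by
        rw [Finset.map_perm_mul, hτ S, ← Finset.map_perm_mul, mul_inv_cancel]
        ext x
        rw [Finset.mem_map_equiv]
        rfl
      obtain ⟨g, hg⟩ := (map_firstLetters_iff n).1 hS
      have hh : h = youngSubgroupHom n g * (τ S)⁻¹ := by rw [hg, mul_inv_cancel_right]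
      have ha : a = signRep n g (signRep n g⁻¹ a) := by
        rw [← Module.End.mul_apply, ← map_mul, mul_inv_cancel, map_one, Module.End.one_apply]
      rw [hh, ha, Representation.IndV.mk_hom_mul]
      refine ⟨(signRep n g⁻¹ a) • V3.basis n S, ?_⟩
      rw [map_smul, Module.Basis.constr_basis, ← map_smul, smul_eq_mul, mul_one]
    have hid : (LinearMap.range Θ).mkQ = 0 := Representation.IndV.hom_ext _ _ fun h =>
      LinearMap.ext fun a => (Submodule.Quotient.mk_eq_zero _).2 (key h a)
    rintro x -
    exact (Submodule.Quotient.mk_eq_zero _).1 (LinearMap.congr_fun hid x)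
  have : Module.Finite ℂ (V3 n) := Module.Finite.of_basis (V3.basis n)
  have hinj : Function.Injective (V3.ofInd n ∘ₗ Θ) :=
    LinearMap.injective_iff_surjective.2 ((V3.ofInd_surjective n).comp hΘ)
  intro x y hxy
  obtain ⟨x, rfl⟩ := hΘ x
  obtain ⟨y, rfl⟩ := hΘ y
  rw [hinj hxy]

/-- `V_{n,3}` is induced from the sign character of the Young subgroup. -/
def V3.equivInd :
    (V3.rep n).Equiv (Representation.ind (youngSubgroupHom n) (signRep n)) :=
  (Representation.Equiv.mk (LinearEquiv.ofBijective (V3.ofInd n)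
    ⟨V3.ofInd_injective n, V3.ofInd_surjective n⟩) (fun g => by
      refine Representation.IndV.hom_ext _ _ fun h => LinearMap.ext fun a => ?_
      change V3.ofInd n (Representation.ind _ _ g (Representation.IndV.mk _ _ h a)) =
        V3.rep n g (V3.ofInd n (Representation.IndV.mk _ _ h a))
      rw [Representation.ind_mk, V3.ofInd_mk, V3.ofInd_mk, map_smul, mul_inv_rev, inv_inv, map_mul,
        Module.End.mul_apply]) :
    (Representation.ind (youngSubgroupHom n) (signRep n)).Equiv (V3.rep n)).symm

end Induced

end

/-! ### Distinct eigenvalues and the decomposition into eigenspaces -/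

noncomputable section

/-- The eigenvalue `1 + (n - i) (-1)^(n - i)` of `φ`. -/
def jacobiEigenvalue (n : ℕ) (i : Fin n) : ℂ :=
  1 + ((n : ℂ) - (i : ℕ)) * (-1) ^ (n - (i : ℕ))

theorem jacobiEigenvalue_eq_intCast (n : ℕ) (i : Fin n) :
    jacobiEigenvalue n i = ((1 + ((n - i : ℕ) : ℤ) * (-1) ^ (n - (i : ℕ)) : ℤ) : ℂ) := by
  rw [jacobiEigenvalue]
  push_cast [Nat.cast_sub i.isLt.le]
  rfl

/-- The values are 1 ± m with m = n - i ≥ 1, and 1 + m = 1 - m' is impossible for positive m and m'.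
-/
theorem jacobiEigenvalue_injective (n : ℕ) : Function.Injective (jacobiEigenvalue n) := by
  intro i j h
  rw [jacobiEigenvalue_eq_intCast, jacobiEigenvalue_eq_intCast, Int.cast_inj] at h
  have hi := i.isLt
  have hj := j.isLt
  apply Fin.ext
  rcases neg_one_pow_eq_or ℤ (n - (i : ℕ)) with h1 | h1 <;>
  rcases neg_one_pow_eq_or ℤ (n - (j : ℕ)) with h2 | h2 <;> rw [h1, h2] at h <;> omega

theorem jacobiEigenvalue_last (n : ℕ) [NeZero n] :
    jacobiEigenvalue n ⟨n - 1, Nat.sub_one_lt (NeZero.ne n)⟩ = 0 := by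
  have hn := NeZero.ne n
  rw [jacobiEigenvalue_eq_intCast]
  simp only [show n - (n - 1) = 1 by omega]
  norm_num

namespace V3

variable {n : ℕ}

theorem nontrivial_specht (i : Fin n) (t : Tableau (twoColumnShape n i) (2 * n - 1)) :
    Nontrivial t.specht.toSubmodule := by
  refine ⟨⟨⟨t.youngSymmetrizer, Submodule.subset_span ⟨1, by simp⟩⟩, 0, fun h => ?_⟩⟩
  exact t.youngSymmetrizer_ne_zero twoColumnShape_snd (congrArg Subtype.val h)

/-- The algebra of equivariant endomorphisms. -/
def commutant (n : ℕ) : Subalgebra ℂ (Module.End ℂ (V3 n)) :=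
  Subalgebra.centralizer ℂ (Set.range (V3.rep n))

theorem mem_commutant {T : Module.End ℂ (V3 n)} :
    T ∈ commutant n ↔ ∀ τ, T * V3.rep n τ = V3.rep n τ * T := by
  rw [commutant, Subalgebra.mem_centralizer_iff]
  constructor
  · intro h τ
    exact (h _ ⟨τ, rfl⟩).symm
  · rintro h _ ⟨τ, rfl⟩
    exact (h τ).symm

variable [NeZero n]

/-- The eigenspaces of `φ`. -/
def eigenRep (n : ℕ) [NeZero n] (i : Fin n) : Subrepresentation (V3.rep n) where
  toSubmodule := Module.End.eigenspace (jacobiMap n) (jacobiEigenvalue n i)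
  apply_mem_toSubmodule g x hx := by
    rw [Module.End.mem_eigenspace_iff] at hx ⊢
    rw [← Module.End.mul_apply, jacobiMap_mul_rep, Module.End.mul_apply, hx, map_smul]

theorem mem_eigenRep {i : Fin n} {x : V3 n} :
    x ∈ eigenRep n i ↔ jacobiMap n x = jacobiEigenvalue n i • x :=
  Module.End.mem_eigenspace_iff

theorem ofSpecht_mem (i : Fin n) (t : Tableau (twoColumnShape n i) (2 * n - 1)) (y) :
    (ofSpecht t).toLinearMap y ∈ eigenRep n i :=
  mem_eigenRep.2 (jacobiMap_ofSpecht i t y)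

theorem eigenRep_ne_bot (i : Fin n) :
    Module.End.eigenspace (jacobiMap n) (jacobiEigenvalue n i) ≠ ⊥ := by
  obtain ⟨t⟩ := tableau_nonempty n i
  have := nontrivial_specht i t
  obtain ⟨y, hy⟩ := exists_ne (0 : t.specht.toSubmodule)
  refine (Submodule.ne_bot_iff _).2 ⟨_, ofSpecht_mem i t y, fun h => hy ?_⟩
  exact ofSpecht_injective i t (by rw [h, map_zero])

/-- Here the two counts meet: at most n dimensions for the commutant, and n distinct eigenvalues of
φ. -/
theorem isScalarOn_eigenRep (i : Fin n) : (eigenRep n i).IsScalarOn := by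
  intro T hT
  obtain ⟨c, hc⟩ := Subalgebra.exists_smul_on_eigenspaces (jacobiMap n)
    (jacobiEigenvalue_injective n) eigenRep_ne_bot (commutant n)
    (mem_commutant.2 jacobiMap_mul_rep) (orbitEntries n)
    (fun T hT => eq_zero_of_orbitEntries_eq_zero (mem_commutant.1 hT)) (mem_commutant.2 hT)
  exact ⟨c i, hc i⟩

theorem isInternal_eigenRep : DirectSum.IsInternal fun i => (eigenRep n i).toSubmodule := by
  have : Nonempty (Fin n) := ⟨0⟩
  rw [DirectSum.isInternal_submodule_iff_iSupIndep_and_iSup_eq_top]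
  exact ⟨(Module.End.eigenspaces_iSupIndep (jacobiMap n)).comp (jacobiEigenvalue_injective n),
    Subalgebra.iSup_eigenspace_eq_top (jacobiMap n)
    (jacobiEigenvalue_injective n) eigenRep_ne_bot (commutant n)
    (mem_commutant.2 jacobiMap_mul_rep) (orbitEntries n)
    (fun T hT => eq_zero_of_orbitEntries_eq_zero (mem_commutant.1 hT))⟩

/-- The eigenspaces of `φ` are isomorphic to the Specht modules. -/
def eigenRepEquiv (i : Fin n) (t : Tableau (twoColumnShape n i) (2 * n - 1)) :
    (eigenRep n i).toRepresentation.Equiv t.spechtRep :=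
  Subrepresentation.equivOfRangeEq (ofSpecht_injective i t) (by
    have := nontrivial_specht i t
    exact (isScalarOn_eigenRep i).range_eq (ofSpecht_injective i t) (ofSpecht_mem i t))

theorem eq_eigenRep_of_equiv (i : Fin n) (t : Tableau (twoColumnShape n i) (2 * n - 1))
    {U : Subrepresentation (V3.rep n)} (e : U.toRepresentation.Equiv t.spechtRep) :
    U = eigenRep n i :=
  (isScalarOn_eigenRep i).eq_of_equiv
    (fun h => eigenRep_ne_bot i (congrArg Subrepresentation.toSubmodule h))
    ((eigenRepEquiv i t).trans e.symm)

theorem eigenRep_injective : Function.Injective (eigenRep n) := by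
  intro i j h
  obtain ⟨x, hx, hx0⟩ := Submodule.exists_mem_ne_zero_of_ne_bot (eigenRep_ne_bot i)
  have h1 : jacobiMap n x = jacobiEigenvalue n i • x := mem_eigenRep.1 hx
  have h2 : jacobiMap n x = jacobiEigenvalue n j • x := mem_eigenRep.1 (h ▸ hx)
  exact jacobiEigenvalue_injective n (smul_left_injective ℂ hx0 (h1.symm.trans h2))

/-- The decomposition of `V_{n,3}` into Specht modules. -/
def equivDirectSum (t : ∀ i : Fin n, Tableau (twoColumnShape n i) (2 * n - 1)) :
    (V3.rep n).Equiv (Representation.directSum fun i => (t i).spechtRep) :=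
  (Representation.Equiv.mk
    ((DFinsupp.mapRange.linearEquiv fun i => (eigenRepEquiv i (t i)).toLinearEquiv.symm).trans
      (LinearEquiv.ofBijective (DirectSum.coeLinearMap fun i => (eigenRep n i).toSubmodule)
        isInternal_eigenRep)) (fun g => by
      refine DirectSum.linearMap_ext _ fun i => LinearMap.ext fun y => ?_
      have h1 := LinearMap.congr_fun ((eigenRepEquiv i (t i)).symm.isIntertwining' g) y
      have h2 := congrArg Subtype.val h1
      simp only [LinearMap.comp_apply, Representation.directSum, MonoidHom.coe_mk, OneHom.coe_mk,
        LinearEquiv.coe_coe, LinearEquiv.trans_apply, DirectSum.lmap_lof]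
      have h3 : ∀ z, DirectSum.coeLinearMap (fun i => (eigenRep n i).toSubmodule)
          (DFinsupp.mapRange.linearEquiv (fun i => (eigenRepEquiv i (t i)).toLinearEquiv.symm)
            (DirectSum.lof ℂ (Fin n) (fun i => (t i).specht.toSubmodule) i z)) =
          ((eigenRepEquiv i (t i)).symm.toLinearMap z : V3 n) := by
        intro z
        have h4 : DFinsupp.mapRange.linearEquiv
            (fun i => (eigenRepEquiv i (t i)).toLinearEquiv.symm)
            (DirectSum.lof ℂ (Fin n) (fun i => (t i).specht.toSubmodule) i z) =
            DirectSum.lof ℂ (Fin n) (fun i => (eigenRep n i).toSubmodule) i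
              ((eigenRepEquiv i (t i)).toLinearEquiv.symm z) :=
          DFinsupp.mapRange_single (hf := fun _ => map_zero _)
        rw [h4, DirectSum.coeLinearMap_lof]
        rfl
      exact (h3 _).trans (h2.trans (congrArg (V3.rep n g) (h3 y).symm))) :
    (Representation.directSum fun i => (t i).spechtRep).Equiv (V3.rep n)).symm

end V3
end
theorem mainTheorem2 (n : ℕ) [NeZero n]
    (t : ∀ i : Fin n, Tableau (twoColumnShape n i) (2 * n - 1)) :
    -- `V_{n,3}` is induced from the sign representation of `S_n × S_{n-1}`
    Nonempty ((V3.rep n).Equiv (Representation.ind (youngSubgroupHom n) (signRep n))) ∧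
    -- `V_{n,3}` is the direct sum of the irreducible, pairwise non-isomorphic `S^{2^i 1^{2n-1-2i}}`
    (∀ i, (t i).spechtRep.IsIrreducible) ∧
    (∀ i j, Nonempty ((t i).spechtRep.Equiv (t j).spechtRep) → i = j) ∧
    Nonempty ((V3.rep n).Equiv (Representation.directSum fun i => (t i).spechtRep)) ∧
    -- `W i` is the unique submodule of `V_{n,3}` isomorphic to `S^{2^i 1^{2n-1-2i}}`
    ∃ W : Fin n → Subrepresentation (V3.rep n),
      (∀ i (U : Subrepresentation (V3.rep n)),
        Nonempty (U.toRepresentation.Equiv (t i).spechtRep) ↔ U = W i) ∧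
      DirectSum.IsInternal (fun i => (W i).toSubmodule) ∧
      -- `φ` acts on `W i` as the scalar `w_i`
      (∀ i : Fin n, ∀ x ∈ W i,
        V3.jacobiMap n x = (1 + ((n : ℂ) - (i : ℕ)) * (-1) ^ (n - (i : ℕ))) • x) ∧
      -- the kernel of `φ` is the submodule isomorphic to `S^{2^{n-1} 1}`
      LinearMap.ker (V3.jacobiMap n) =
        (W ⟨n - 1, Nat.sub_one_lt (NeZero.ne n)⟩).toSubmodule := by
  refine ⟨⟨V3.equivInd n⟩, ?_, ?_, ⟨V3.equivDirectSum t⟩, V3.eigenRep n, ?_,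
    V3.isInternal_eigenRep, fun i x hx => V3.mem_eigenRep.1 hx, ?_⟩
  · intro i
    have := V3.nontrivial_specht i (t i)
    exact (V3.isScalarOn_eigenRep i).isIrreducible (V3.ofSpecht_injective i (t i))
      (V3.ofSpecht_mem i (t i))
  · rintro i j ⟨e⟩
    exact V3.eigenRep_injective
      (V3.eq_eigenRep_of_equiv j (t j) ((V3.eigenRepEquiv i (t i)).trans e))
  · intro i U
    refine ⟨fun ⟨e⟩ => V3.eq_eigenRep_of_equiv i (t i) e, ?_⟩
    rintro rfl
    exact ⟨V3.eigenRepEquiv i (t i)⟩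
  · ext x
    rw [LinearMap.mem_ker]
    refine Iff.trans ?_ V3.mem_eigenRep.symm
    -- For i = n - 1 the exponent n - i is 1, so w_i = 1 - 1 = 0 and the eigenspace is the kernel.
    rw [jacobiEigenvalue_last, zero_smul]
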